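/- Let $\alpha,M,M_0,M_1>0$. For a positive integer $p$ let $\mathcal F_{p,\alpha}(M,M_0,M_1)$ be the set of symmetric positive definite $p\times p$ matrices $\Sigma=(\sigma_{ij})$ with $\max_j\sum_{i:|i-j|>m}|\sigma_{ij}|\le M m^{-\alpha}$ for all integers $m\ge 1$, $\lambda_{\max}(\Sigma)\le M_0$ and $\lambda_{\min}(\Sigma)\ge M_1$. Let $p=p_0+q$ with positive integers $p_0,q$; split the coordinates into $X$ (the first $p_0$) and $Y$ (the last $q$), and put $\psi(\Sigma)=\Sigma_{YX}\Sigma_{XX}^{-1}$. For a symmetric matrix $A=(a_{ij})$ let $T_k(A)=(w_{ij}a_{ij})$, where $w_{ij}=1$ if $|i-j|\le k/2$, $w_{ij}=2-2|i-j|/k$ if $k/2<|i-j|<k$, and $w_{ij}=0$ otherwise, and for $\epsilon>0$ let $T_k^{(\epsilon)}(A)=T_k(A)+[\{\epsilon-\lambda_{\min}(T_k(A))\}\vee 0]\,I_p$. For observations $Z_1,\dots,Z_n$ let $S_n=n^{-1}\sum_{i=1}^n Z_iZ_i^T$, and let $\|\cdot\|$ be the spectral norm. Theorem. There are positive constants $C$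 and $\lambda$ depending only on $M,M_0,M_1$ and $\alpha$ such that the following holds. Let $p_0=p_{0,n}$, $q=q_n$, $k=k_n$ be sequences of positive integers, $p=p_n=p_{0,n}+q_n$, with $k\vee\log p=o(n)$, and let $\epsilon_n>0$. Then for all sufficiently large $n$, for all $\Sigma_0\in\mathcal F_{p,\alpha}(M,M_0,M_1)$ with $\lfloor k/2\rfloor>\{4M/\lambda_{\min}(\Sigma_0)\}^{1/\alpha}$, and for $Z_1,\dots,Z_n$ independent with distribution $N_p(0,\Sigma_0)$, $$E\big\|\Sigma_{0,YX}\Sigma_{0,XX}^{-1}-\psi\{T_k^{(\epsilon_n)}(S_n)\}\big\|^2\le C\Big\{\frac{k+\log p}{n}+k^{-2\alpha}+\epsilon_n^2+\frac{p^{1/2}5^{k/2}e^{-\lambda n}}{\epsilon_n^2}\Big\}.$$ -/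

import Mathlib

open Filter Asymptotics MeasureTheory ProbabilityTheory
open scoped Matrix Matrix.Norms.L2Operator

namespace BandableRegression

noncomputable section

/-- The smallest eigenvalue of a real symmetric matrix. -/
def minEig {p : ℕ} (A : Matrix (Fin p) (Fin p) ℝ) : ℝ := sInf (spectrum ℝ A)

/-- The largest eigenvalue of a real symmetric matrix. -/
def maxEig {p : ℕ} (A : Matrix (Fin p) (Fin p) ℝ) : ℝ := sSup (spectrum ℝ A)

/-- The distance `|i - j|` of two indices, as a natural number. -/
def idxDist {p : ℕ} (i j : Fin p) : ℕ := ((i : ℤ) - (j : ℤ)).natAbs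

/-- The class of bandable covariance matrices with decay rate `α`: symmetric positive definite
matrices with `max_j ∑_{i : |i - j| > m} |σ_ij| ≤ M m ^ (-α)` for all `m ≥ 1`, with largest
eigenvalue at most `M₀` and smallest eigenvalue at least `M₁`. -/
def bandableClass (p : ℕ) (α M M₀ M₁ : ℝ) : Set (Matrix (Fin p) (Fin p) ℝ) :=
  {S | S.PosDef ∧
    (∀ m : ℕ, 1 ≤ m → ∀ j : Fin p,
      ∑ i with m < idxDist i j, |S i j| ≤ M * (m : ℝ) ^ (-α)) ∧
    maxEig S ≤ M₀ ∧ M₁ ≤ minEig S}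

/-- The tapering weights: `1` if `|i - j| ≤ k / 2`, then `2 - 2 |i - j| / k` if
`k / 2 < |i - j| < k`, and `0` if `|i - j| ≥ k`. -/
def taperWeight (k d : ℕ) : ℝ :=
  if (d : ℝ) ≤ (k : ℝ) / 2 then 1
  else if d < k then 2 - 2 * (d : ℝ) / (k : ℝ)
  else 0

/-- The tapering operator `T_k`. -/
def taper {p : ℕ} (k : ℕ) (A : Matrix (Fin p) (Fin p) ℝ) : Matrix (Fin p) (Fin p) ℝ :=
  Matrix.of fun i j => taperWeight k (idxDist i j) * A i j

/-- The eigenvalue adjustment `A^(ε) = A + [{ε - λ_min(A)} ∨ 0] I`. -/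
def adjust {p : ℕ} (ε : ℝ) (A : Matrix (Fin p) (Fin p) ℝ) : Matrix (Fin p) (Fin p) ℝ :=
  A + max (ε - minEig A) 0 • (1 : Matrix (Fin p) (Fin p) ℝ)

/-- The block `A_XX`: rows and columns of the first `p₀` coordinates. -/
def blockXX {p₀ q : ℕ} (A : Matrix (Fin (p₀ + q)) (Fin (p₀ + q)) ℝ) :
    Matrix (Fin p₀) (Fin p₀) ℝ :=
  A.submatrix (Fin.castAdd q) (Fin.castAdd q)

/-- The block `A_YX`: rows of the last `q` coordinates, columns of the first `p₀` coordinates. -/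
def blockYX {p₀ q : ℕ} (A : Matrix (Fin (p₀ + q)) (Fin (p₀ + q)) ℝ) :
    Matrix (Fin q) (Fin p₀) ℝ :=
  A.submatrix (Fin.natAdd p₀) (Fin.castAdd q)

/-- The regression coefficient (conditional mean operator) `ψ(A) = A_YX A_XX⁻¹`. -/
def regCoef {p₀ q : ℕ} (A : Matrix (Fin (p₀ + q)) (Fin (p₀ + q)) ℝ) :
    Matrix (Fin q) (Fin p₀) ℝ :=
  blockYX A * (blockXX A)⁻¹

/-- The sample covariance matrix `S_n = n⁻¹ ∑ᵢ zᵢ zᵢᵀ` of centered observations. -/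
def sampleCov {n p : ℕ} (z : Fin n → EuclideanSpace ℝ (Fin p)) : Matrix (Fin p) (Fin p) ℝ :=
  (n : ℝ)⁻¹ • ∑ i, Matrix.vecMulVec (z i) (z i)

/-- `Z₁, …, Z_n` are independent random vectors with distribution `N_p(0, S)`. -/
def IsGaussianSample {Ω : Type*} [MeasurableSpace Ω] (P : Measure Ω) {n p : ℕ}
    (S : Matrix (Fin p) (Fin p) ℝ) (Z : Fin n → Ω → EuclideanSpace ℝ (Fin p)) : Prop :=
  iIndepFun Z P ∧ ∀ i, HasLaw (Z i) (multivariateGaussian 0 S) P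

/-- The squared spectral-norm loss `‖ψ(S) - ψ(T_k^(ε)(S_n))‖²` at the sample `z`. -/
def taperLoss {n p₀ q : ℕ} (k : ℕ) (ε : ℝ) (S : Matrix (Fin (p₀ + q)) (Fin (p₀ + q)) ℝ)
    (z : Fin n → EuclideanSpace ℝ (Fin (p₀ + q))) : ℝ :=
  ‖regCoef S - regCoef (adjust ε (taper k (sampleCov z)))‖ ^ 2

end

end BandableRegression

/-! The loss is bounded pathwise by the deviation Δ = ‖T_k(S_n) − T_k(Σ₀)‖, the bias ‖T_k(Σ₀) − Σ₀‖
and ε. The map ψ is Lipschitz with a constant inversely proportional to the coercivity of the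
perturbed matrix. If Δ ≤ M₁/4, that coercivity is at least M₁/2, because the condition on ⌊k/2⌋
keeps the bias below λ_min(Σ₀)/4; the loss is then of order Δ² + bias² + ε². If Δ is larger, the
adjustment still guarantees coercivity ε, at the price of a term Δ²/ε²
(`exists_norm_regCoef_sub_adjust_sq_le`).

The bias is O(k^(-α)) by Schur's test. For Δ, the tapering weights combine triangular weights, which
arise by summing over sliding windows of length at most k. Nets on the windows reduce ‖T_k(D)‖ to
the largest |wᵀDw| over about (p + k)·25^k test vectors (`norm_taper_le`,
`exists_taper_test_vectors`). For fixed w, wᵀ(S_n − Σ₀)w is a centred average of squared Gaussians,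
so E exp(θΔ) ≤ exp(7(k + log p) + O(θ²/n)) for θ up to a multiple of n.

Taking θ of order √(n(k + log p)) gives EΔ² = O((k + log p)/n). Taking θ of order n makes the
contribution of {Δ > M₁/4} exponentially small, since k + log p = o(n) is absorbed by the exponent.
The factor p^(1/2)·5^(k/2) is therefore not needed; it only has to be at least 1. -/

namespace BandableRegression

/-! ### Spectral norm bounds from bilinear and quadratic forms -/

section Bilinear

variable {m n : Type*} [Fintype m] [Fintype n]

lemma dotProduct_ofLp_self (x : EuclideanSpace ℝ m) : x.ofLp ⬝ᵥ x.ofLp = ‖x‖ ^ 2 := by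
  rw [EuclideanSpace.real_norm_sq_eq]
  simp [dotProduct, sq]

lemma abs_dotProduct_ofLp_le (x y : EuclideanSpace ℝ m) :
    |x.ofLp ⬝ᵥ y.ofLp| ≤ ‖x‖ * ‖y‖ := by
  have h := abs_real_inner_le_norm x y
  rwa [EuclideanSpace.inner_eq_star_dotProduct, star_trivial, dotProduct_comm] at h

lemma abs_dotProduct_mulVec_le [DecidableEq n] (A : Matrix m n ℝ) (x : EuclideanSpace ℝ m)
    (y : EuclideanSpace ℝ n) : |x.ofLp ⬝ᵥ (A *ᵥ y.ofLp)| ≤ ‖A‖ * ‖x‖ * ‖y‖ := by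
  have h1 := abs_dotProduct_ofLp_le x (WithLp.toLp 2 (A *ᵥ y.ofLp))
  have h2 : ‖(WithLp.toLp 2 (A *ᵥ y.ofLp) : EuclideanSpace ℝ m)‖ ≤ ‖A‖ * ‖y‖ :=
    Matrix.l2_opNorm_mulVec A y
  calc _ ≤ ‖x‖ * ‖(WithLp.toLp 2 (A *ᵥ y.ofLp) : EuclideanSpace ℝ m)‖ := h1
    _ ≤ ‖x‖ * (‖A‖ * ‖y‖) := by gcongr
    _ = _ := by ring

lemma l2_opNorm_le_of_mulVec_le [DecidableEq n] (A : Matrix m n ℝ) {c : ℝ} (hc : 0 ≤ c)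
    (h : ∀ y : EuclideanSpace ℝ n,
      ‖(WithLp.toLp 2 (A *ᵥ y.ofLp) : EuclideanSpace ℝ m)‖ ≤ c * ‖y‖) : ‖A‖ ≤ c := by
  rw [Matrix.l2_opNorm_def]
  exact ContinuousLinearMap.opNorm_le_bound _ hc h

/-- Testing with x a multiple of `A y` rescaled to the norm of y turns the mean of squares into
‖y‖². The mean form is what sums over windows produce directly. -/
lemma l2_opNorm_le_of_dotProduct_le [DecidableEq n] (A : Matrix m n ℝ) {c : ℝ} (hc : 0 ≤ c)
    (h : ∀ (x : EuclideanSpace ℝ m) (y : EuclideanSpace ℝ n),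
      x.ofLp ⬝ᵥ (A *ᵥ y.ofLp) ≤ c * ((‖x‖ ^ 2 + ‖y‖ ^ 2) / 2)) : ‖A‖ ≤ c := by
  refine l2_opNorm_le_of_mulVec_le A hc fun y => ?_
  set z : EuclideanSpace ℝ m := WithLp.toLp 2 (A *ᵥ y.ofLp) with hz
  rcases eq_or_ne z 0 with h0 | h0
  · rw [h0, norm_zero]; positivity
  rcases eq_or_ne y 0 with hy | hy
  · simp [hz, hy]
  have hzn : 0 < ‖z‖ := norm_pos_iff.2 h0
  have hyn : 0 < ‖y‖ := norm_pos_iff.2 hy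
  have h1 := h ((‖y‖ / ‖z‖) • z) y
  have h2 : ((‖y‖ / ‖z‖) • z).ofLp ⬝ᵥ (A *ᵥ y.ofLp) = ‖y‖ * ‖z‖ := by
    have : A *ᵥ y.ofLp = z.ofLp := rfl
    rw [this, WithLp.ofLp_smul, smul_dotProduct, dotProduct_ofLp_self, smul_eq_mul]
    field_simp
  have h3 : ‖(‖y‖ / ‖z‖) • z‖ = ‖y‖ := by
    rw [norm_smul, Real.norm_of_nonneg (by positivity)]
    field_simp
  rw [h2, h3] at h1
  nlinarith

/-- Schur's test for a matrix whose absolute row and column sums are at most `c`. -/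
lemma l2_opNorm_le_of_sum_le [DecidableEq n] (A : Matrix m n ℝ) {c : ℝ} (hc : 0 ≤ c)
    (hr : ∀ i, ∑ j, |A i j| ≤ c) (hcol : ∀ j, ∑ i, |A i j| ≤ c) : ‖A‖ ≤ c := by
  refine l2_opNorm_le_of_dotProduct_le A hc fun x y => ?_
  have h1 : x.ofLp ⬝ᵥ (A *ᵥ y.ofLp) = ∑ i, ∑ j, x i * (A i j * y j) := by
    simp [dotProduct, Matrix.mulVec, Finset.mul_sum]
  have h2 : ∑ i, ∑ j, x i * (A i j * y j)
      ≤ ∑ i, ∑ j, (|A i j| * x i ^ 2 / 2 + |A i j| * y j ^ 2 / 2) := by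
    refine Finset.sum_le_sum fun i _ => Finset.sum_le_sum fun j _ => ?_
    calc x i * (A i j * y j) ≤ |x i * (A i j * y j)| := le_abs_self _
      _ = |A i j| * (|x i| * |y j|) := by rw [abs_mul, abs_mul]; ring
      _ ≤ |A i j| * ((|x i| ^ 2 + |y j| ^ 2) / 2) := by
        gcongr
        nlinarith [sq_nonneg (|x i| - |y j|)]
      _ = _ := by rw [sq_abs, sq_abs]; ring
  have h3 : ∑ i, ∑ j, |A i j| * x i ^ 2 / 2 ≤ c * ‖x‖ ^ 2 / 2 := by
    rw [EuclideanSpace.real_norm_sq_eq, Finset.mul_sum, Finset.sum_div]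
    refine Finset.sum_le_sum fun i _ => ?_
    rw [← Finset.sum_div, ← Finset.sum_mul]
    have := hr i
    gcongr
  have h4 : ∑ i, ∑ j, |A i j| * y j ^ 2 / 2 ≤ c * ‖y‖ ^ 2 / 2 := by
    rw [Finset.sum_comm, EuclideanSpace.real_norm_sq_eq, Finset.mul_sum, Finset.sum_div]
    refine Finset.sum_le_sum fun i _ => ?_
    rw [← Finset.sum_div, ← Finset.sum_mul]
    have := hcol i
    gcongr
  rw [h1]
  refine h2.trans ?_
  simp only [Finset.sum_add_distrib]
  linarith

/-- A symmetric form between `0` and `c‖x‖²` has matrix of norm at most `c`. -/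
lemma l2_opNorm_le_of_quadratic_le [DecidableEq m] (A : Matrix m m ℝ) (hA : A.IsHermitian) {c : ℝ} (hc : 0 ≤ c)
    (h0 : ∀ x : EuclideanSpace ℝ m, 0 ≤ x.ofLp ⬝ᵥ (A *ᵥ x.ofLp))
    (h1 : ∀ x : EuclideanSpace ℝ m, x.ofLp ⬝ᵥ (A *ᵥ x.ofLp) ≤ c * ‖x‖ ^ 2) : ‖A‖ ≤ c := by
  refine l2_opNorm_le_of_dotProduct_le A hc fun x y => ?_
  have ha := h1 (x + y)
  have hb := h0 (x - y)
  have hs : y.ofLp ⬝ᵥ (A *ᵥ x.ofLp) = x.ofLp ⬝ᵥ (A *ᵥ y.ofLp) := by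
    have : Aᵀ = A := by simpa [Matrix.IsHermitian, Matrix.conjTranspose_eq_transpose_of_trivial] using hA
    rw [Matrix.dotProduct_mulVec, ← Matrix.mulVec_transpose, this, dotProduct_comm]
  -- Polarization: 4 xᵀAy is the form at x + y minus the form at x − y. The second is nonnegative,
  -- and ‖x + y‖² is at most twice ‖x‖² + ‖y‖².
  have hp : ‖x + y‖ ^ 2 + ‖x - y‖ ^ 2 = 2 * (‖x‖ ^ 2 + ‖y‖ ^ 2) := by
    have := parallelogram_law_with_norm ℝ x y
    nlinarith
  have hc2 : 0 ≤ c * ‖x - y‖ ^ 2 := by positivity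
  simp only [WithLp.ofLp_add, WithLp.ofLp_sub, Matrix.mulVec_add, Matrix.mulVec_sub,
    add_dotProduct, sub_dotProduct, dotProduct_add, dotProduct_sub] at ha hb
  have := h1 (x + y)
  nlinarith

lemma isUnit_det_of_coercive [DecidableEq m] (A : Matrix m m ℝ) {c : ℝ} (hc : 0 < c)
    (h : ∀ x : EuclideanSpace ℝ m, c * ‖x‖ ^ 2 ≤ x.ofLp ⬝ᵥ (A *ᵥ x.ofLp)) : IsUnit A.det := by
  rw [← Matrix.isUnit_iff_isUnit_det, ← Matrix.mulVec_injective_iff_isUnit]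
  refine (injective_iff_map_eq_zero (Matrix.mulVecLin A)).2 fun x hx => ?_
  have hx' : A *ᵥ x = 0 := hx
  have h1 := h (WithLp.toLp 2 x)
  simp only [hx', dotProduct_zero] at h1
  have h2 : ‖(WithLp.toLp 2 x : EuclideanSpace ℝ m)‖ ^ 2 ≤ 0 := by
    by_contra! hlt
    nlinarith
  have h3 : (WithLp.toLp 2 x : EuclideanSpace ℝ m) = 0 := by
    rw [← norm_eq_zero]
    exact pow_eq_zero_iff (two_ne_zero) |>.1 (le_antisymm h2 (by positivity))
  simpa using h3

lemma l2_opNorm_inv_le_of_coercive [DecidableEq m] (A : Matrix m m ℝ) {c : ℝ} (hc : 0 < c)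
    (h : ∀ x : EuclideanSpace ℝ m, c * ‖x‖ ^ 2 ≤ x.ofLp ⬝ᵥ (A *ᵥ x.ofLp)) : ‖A⁻¹‖ ≤ 1 / c := by
  have hu := isUnit_det_of_coercive A hc h
  refine l2_opNorm_le_of_mulVec_le _ (by positivity) fun y => ?_
  set z : EuclideanSpace ℝ m := WithLp.toLp 2 (A⁻¹ *ᵥ y.ofLp) with hz
  have hy : A *ᵥ z.ofLp = y.ofLp := by rw [hz, Matrix.mulVec_mulVec, Matrix.mul_nonsing_inv _ hu, Matrix.one_mulVec]
  have h1 := h z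
  rw [hy] at h1
  have h2 := (le_abs_self _).trans (abs_dotProduct_ofLp_le z y)
  rcases eq_or_lt_of_le (norm_nonneg z) with h0 | h0
  · rw [← h0]; positivity
  · rw [div_mul_eq_mul_div, one_mul, le_div_iff₀ hc]
    nlinarith

end Bilinear

/-! ### Extreme eigenvalues through quadratic forms -/

section Eigenvalues

variable {p : ℕ} {A : Matrix (Fin p) (Fin p) ℝ}

lemma isHermitian_sub_smul_one (hA : A.IsHermitian) (c : ℝ) :
    (A - c • (1 : Matrix (Fin p) (Fin p) ℝ)).IsHermitian :=
  hA.sub (by simp [Matrix.IsHermitian])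

lemma finite_spectrum (A : Matrix (Fin p) (Fin p) ℝ) : (spectrum ℝ A).Finite :=
  Matrix.finite_real_spectrum

open scoped MatrixOrder in
lemma le_quadratic_iff (hA : A.IsHermitian) (c : ℝ) :
    (∀ x : EuclideanSpace ℝ (Fin p), c * ‖x‖ ^ 2 ≤ x.ofLp ⬝ᵥ (A *ᵥ x.ofLp)) ↔
      ∀ l ∈ spectrum ℝ A, c ≤ l := by
  rw [← algebraMap_le_iff_le_spectrum (a := A) hA, Matrix.le_iff,
    Matrix.posSemidef_iff_dotProduct_mulVec, Algebra.algebraMap_eq_smul_one]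
  have key : ∀ x : EuclideanSpace ℝ (Fin p),
      x.ofLp ⬝ᵥ ((A - c • (1 : Matrix (Fin p) (Fin p) ℝ)) *ᵥ x.ofLp)
        = x.ofLp ⬝ᵥ (A *ᵥ x.ofLp) - c * ‖x‖ ^ 2 := fun x => by
    rw [Matrix.sub_mulVec, Matrix.smul_mulVec, Matrix.one_mulVec, dotProduct_sub, dotProduct_smul,
      dotProduct_ofLp_self, smul_eq_mul]
  constructor
  · intro h
    refine ⟨isHermitian_sub_smul_one hA c, fun x => ?_⟩
    have := key (WithLp.toLp 2 x)
    have h2 := h (WithLp.toLp 2 x)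
    simp only [star_trivial]
    linarith
  · rintro ⟨-, h⟩ x
    have := key x
    have h2 := h x.ofLp
    simp only [star_trivial] at h2
    linarith

lemma minEig_mul_le (hA : A.IsHermitian) (x : EuclideanSpace ℝ (Fin p)) :
    minEig A * ‖x‖ ^ 2 ≤ x.ofLp ⬝ᵥ (A *ᵥ x.ofLp) :=
  (le_quadratic_iff hA _).2 (fun _ hl => csInf_le (finite_spectrum A).bddBelow hl) x

lemma spectrum_nonempty [NeZero p] (hA : A.IsHermitian) : (spectrum ℝ A).Nonempty := by
  rw [hA.spectrum_real_eq_range_eigenvalues]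
  exact Set.range_nonempty _

/-- Positive dimension is essential: for p = 0 the spectrum is empty and `sInf` takes the default
value 0. -/
lemma le_minEig [NeZero p] (hA : A.IsHermitian) {c : ℝ}
    (h : ∀ x : EuclideanSpace ℝ (Fin p), c * ‖x‖ ^ 2 ≤ x.ofLp ⬝ᵥ (A *ᵥ x.ofLp)) :
    c ≤ minEig A :=
  le_csInf (spectrum_nonempty hA) ((le_quadratic_iff hA c).1 h)

lemma quadratic_le_maxEig_mul (hA : A.IsHermitian) (x : EuclideanSpace ℝ (Fin p)) :
    x.ofLp ⬝ᵥ (A *ᵥ x.ofLp) ≤ maxEig A * ‖x‖ ^ 2 := by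
  have h := (le_quadratic_iff hA.neg (-maxEig A)).2 (fun l hl => by
    rw [← spectrum.neg_eq, Set.mem_neg] at hl
    have := le_csSup (finite_spectrum A).bddAbove hl
    unfold maxEig
    linarith) x
  rw [Matrix.neg_mulVec, dotProduct_neg] at h
  linarith

/-- Weyl's perturbation inequality for the smallest eigenvalue. -/
lemma minEig_sub_le_minEig [NeZero p] {B : Matrix (Fin p) (Fin p) ℝ} (hA : A.IsHermitian)
    (hB : B.IsHermitian) : minEig A - ‖A - B‖ ≤ minEig B := by
  refine le_minEig hB fun x => ?_
  have h1 := minEig_mul_le hA x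
  have h2 := (le_abs_self _).trans (abs_dotProduct_mulVec_le (A - B) x x)
  rw [Matrix.sub_mulVec, dotProduct_sub] at h2
  nlinarith

lemma minEig_le_norm [NeZero p] (hA : A.IsHermitian) : minEig A ≤ ‖A‖ := by
  have h1 := minEig_mul_le hA (EuclideanSpace.single (0 : Fin p) 1)
  have h2 := (le_abs_self _).trans (abs_dotProduct_mulVec_le A (EuclideanSpace.single (0 : Fin p) 1)
    (EuclideanSpace.single (0 : Fin p) 1))
  simp only [PiLp.norm_single, norm_one, one_pow, mul_one] at h1 h2
  linarith

end Eigenvalues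

/-! ### Blocks and the Lipschitz property of the regression coefficient -/

section Blocks

variable {p₀ q : ℕ} (A B : Matrix (Fin (p₀ + q)) (Fin (p₀ + q)) ℝ)

/-- Extension by zero of a vector on the first coordinates. -/
noncomputable def extendX (q : ℕ) {p₀ : ℕ} (x : EuclideanSpace ℝ (Fin p₀)) :
    EuclideanSpace ℝ (Fin (p₀ + q)) := WithLp.toLp 2 (Fin.append x.ofLp 0)

/-- Extension by zero of a vector on the last coordinates. -/
noncomputable def extendY (p₀ : ℕ) {q : ℕ} (x : EuclideanSpace ℝ (Fin q)) :
    EuclideanSpace ℝ (Fin (p₀ + q)) := WithLp.toLp 2 (Fin.append 0 x.ofLp)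

lemma norm_extendX_sq (x : EuclideanSpace ℝ (Fin p₀)) : ‖extendX q x‖ ^ 2 = ‖x‖ ^ 2 := by
  simp [EuclideanSpace.real_norm_sq_eq, extendX, Fin.sum_univ_add]

lemma norm_extendY_sq (x : EuclideanSpace ℝ (Fin q)) : ‖extendY p₀ x‖ ^ 2 = ‖x‖ ^ 2 := by
  simp [EuclideanSpace.real_norm_sq_eq, extendY, Fin.sum_univ_add]

lemma dotProduct_blockXX (x y : EuclideanSpace ℝ (Fin p₀)) :
    x.ofLp ⬝ᵥ (blockXX A *ᵥ y.ofLp) = (extendX q x).ofLp ⬝ᵥ (A *ᵥ (extendX q y).ofLp) := by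
  simp [dotProduct, Matrix.mulVec, extendX, Fin.sum_univ_add, blockXX]

lemma dotProduct_blockYX (x : EuclideanSpace ℝ (Fin q)) (y : EuclideanSpace ℝ (Fin p₀)) :
    x.ofLp ⬝ᵥ (blockYX A *ᵥ y.ofLp) = (extendY p₀ x).ofLp ⬝ᵥ (A *ᵥ (extendX q y).ofLp) := by
  simp [dotProduct, Matrix.mulVec, extendX, extendY, Fin.sum_univ_add, blockYX]

lemma norm_blockXX_le : ‖blockXX A‖ ≤ ‖A‖ := by
  refine l2_opNorm_le_of_dotProduct_le _ (norm_nonneg _) fun x y => ?_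
  rw [dotProduct_blockXX, ← norm_extendX_sq (q := q) x, ← norm_extendX_sq (q := q) y]
  refine ((le_abs_self _).trans (abs_dotProduct_mulVec_le _ _ _)).trans ?_
  rw [mul_assoc]
  gcongr
  nlinarith [sq_nonneg (‖extendX q x‖ - ‖extendX q y‖)]

lemma norm_blockYX_le : ‖blockYX A‖ ≤ ‖A‖ := by
  refine l2_opNorm_le_of_dotProduct_le _ (norm_nonneg _) fun x y => ?_
  rw [dotProduct_blockYX, ← norm_extendY_sq (p₀ := p₀) x, ← norm_extendX_sq (q := q) y]
  refine ((le_abs_self _).trans (abs_dotProduct_mulVec_le _ _ _)).trans ?_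
  rw [mul_assoc]
  gcongr
  nlinarith [sq_nonneg (‖extendY p₀ x‖ - ‖extendX q y‖)]

variable {A B}

lemma coercive_blockXX {c : ℝ}
    (h : ∀ x : EuclideanSpace ℝ (Fin (p₀ + q)), c * ‖x‖ ^ 2 ≤ x.ofLp ⬝ᵥ (A *ᵥ x.ofLp))
    (x : EuclideanSpace ℝ (Fin p₀)) : c * ‖x‖ ^ 2 ≤ x.ofLp ⬝ᵥ (blockXX A *ᵥ x.ofLp) := by
  rw [dotProduct_blockXX, ← norm_extendX_sq (q := q)]
  exact h _

lemma norm_regCoef_le {c : ℝ} (hc : 0 < c)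
    (h : ∀ x : EuclideanSpace ℝ (Fin (p₀ + q)), c * ‖x‖ ^ 2 ≤ x.ofLp ⬝ᵥ (A *ᵥ x.ofLp)) :
    ‖regCoef A‖ ≤ ‖A‖ / c := by
  have h1 := l2_opNorm_inv_le_of_coercive _ hc (coercive_blockXX h)
  calc ‖regCoef A‖ ≤ ‖blockYX A‖ * ‖(blockXX A)⁻¹‖ := Matrix.l2_opNorm_mul _ _
    _ ≤ ‖A‖ * (1 / c) := by
      gcongr
      exact norm_blockYX_le A
    _ = _ := by ring

/-- With D = A − B, ψ(A) − ψ(B) = (D_YX − ψ(A) D_XX) B_XX⁻¹. Only one factor 1/b occurs, so squaring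
with b = ε costs no more than ε⁻². -/
lemma norm_regCoef_sub_le {a b : ℝ} (ha : 0 < a) (hb : 0 < b)
    (hA : ∀ x : EuclideanSpace ℝ (Fin (p₀ + q)), a * ‖x‖ ^ 2 ≤ x.ofLp ⬝ᵥ (A *ᵥ x.ofLp))
    (hB : ∀ x : EuclideanSpace ℝ (Fin (p₀ + q)), b * ‖x‖ ^ 2 ≤ x.ofLp ⬝ᵥ (B *ᵥ x.ofLp)) :
    ‖regCoef A - regCoef B‖ ≤ (1 + ‖A‖ / a) * ‖A - B‖ / b := by
  have hAu := isUnit_det_of_coercive _ ha (coercive_blockXX hA)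
  have hBu := isUnit_det_of_coercive _ hb (coercive_blockXX hB)
  have hBi := l2_opNorm_inv_le_of_coercive _ hb (coercive_blockXX hB)
  have key : regCoef A - regCoef B
      = (blockYX (A - B) - regCoef A * blockXX (A - B)) * (blockXX B)⁻¹ := by
    have e1 : blockYX (A - B) = blockYX A - blockYX B := rfl
    have e2 : blockXX (A - B) = blockXX A - blockXX B := rfl
    have e3 : regCoef A * blockXX A = blockYX A := by
      rw [regCoef, Matrix.mul_assoc, Matrix.nonsing_inv_mul _ hAu, Matrix.mul_one]
    rw [e1, e2, Matrix.mul_sub, e3, Matrix.sub_mul, Matrix.sub_mul, Matrix.sub_mul,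
      Matrix.mul_assoc (regCoef A), Matrix.mul_nonsing_inv _ hBu, Matrix.mul_one, regCoef, regCoef]
    abel
  rw [key]
  calc _ ≤ ‖blockYX (A - B) - regCoef A * blockXX (A - B)‖ * ‖(blockXX B)⁻¹‖ :=
        Matrix.l2_opNorm_mul _ _
    _ ≤ (‖A - B‖ + ‖A‖ / a * ‖A - B‖) * (1 / b) := by
        refine mul_le_mul ?_ hBi (norm_nonneg _) (by positivity)
        refine (norm_sub_le _ _).trans (add_le_add (norm_blockYX_le _) ?_)
        refine (Matrix.l2_opNorm_mul _ _).trans ?_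
        exact mul_le_mul (norm_regCoef_le ha hA) (norm_blockXX_le _) (norm_nonneg _) (by positivity)
    _ = _ := by ring

end Blocks

/-! ### Tapering and its bias -/

section Taper

variable {p : ℕ}

lemma idxDist_comm (i j : Fin p) : idxDist i j = idxDist j i := by
  unfold idxDist
  omega

lemma taper_isHermitian (k : ℕ) {A : Matrix (Fin p) (Fin p) ℝ} (hA : A.IsHermitian) :
    (taper k A).IsHermitian := by
  refine Matrix.IsHermitian.ext fun i j => ?_
  have := hA.apply i j
  simp only [star_trivial] at this
  simp [taper, idxDist_comm j i, this]

lemma taper_sub (k : ℕ) (A B : Matrix (Fin p) (Fin p) ℝ) :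
    taper k (A - B) = taper k A - taper k B := by
  ext i j
  simp [taper, mul_sub]

lemma taperWeight_nonneg (k d : ℕ) : 0 ≤ taperWeight k d := by
  unfold taperWeight
  split_ifs with h1 h2
  · exact zero_le_one
  · have hk : (0 : ℝ) < k := by exact_mod_cast (Nat.zero_le d).trans_lt h2
    have hd : (d : ℝ) ≤ k := by exact_mod_cast h2.le
    rw [sub_nonneg, div_le_iff₀ hk]
    linarith
  · exact le_rfl

lemma taperWeight_le_one (k d : ℕ) : taperWeight k d ≤ 1 := by
  unfold taperWeight
  split_ifs with h1 h2
  · exact le_rfl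
  · have hk : (0 : ℝ) < k := by exact_mod_cast (Nat.zero_le d).trans_lt h2
    have : 1 ≤ 2 * (d : ℝ) / k := by
      rw [le_div_iff₀ hk]
      linarith
    linarith
  · exact zero_le_one

lemma taperWeight_of_le_half {k d : ℕ} (h : d ≤ k / 2) : taperWeight k d = 1 := by
  have : (d : ℝ) ≤ (k : ℝ) / 2 := by
    have : d * 2 ≤ k := by omega
    rw [le_div_iff₀ two_pos]
    exact_mod_cast this
  simp [taperWeight, this]

/-- Entries within distance ⌊k/2⌋ are unchanged and the others only shrink, so the decay condition
at m = ⌊k/2⌋ bounds the column sums, and by symmetry the row sums; Schur's test applies. -/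
lemma norm_taper_sub_self_le {α M M₀ M₁ : ℝ} {S : Matrix (Fin p) (Fin p) ℝ}
    (hS : S ∈ bandableClass p α M M₀ M₁) (hM : 0 ≤ M) {k : ℕ} (hk : 1 ≤ k / 2) :
    ‖taper k S - S‖ ≤ M * ((k / 2 : ℕ) : ℝ) ^ (-α) := by
  obtain ⟨hpd, hb, -, -⟩ := hS
  have hcol : ∀ j, ∑ i, |(taper k S - S) i j| ≤ M * ((k / 2 : ℕ) : ℝ) ^ (-α) := fun j => by
    refine le_trans ?_ (hb (k / 2) hk j)
    rw [Finset.sum_filter]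
    refine Finset.sum_le_sum fun i _ => ?_
    have he : (taper k S - S) i j = (taperWeight k (idxDist i j) - 1) * S i j := by
      simp [taper, sub_mul]
    rw [he, abs_mul]
    split_ifs with h
    · refine mul_le_of_le_one_left (abs_nonneg _) ?_
      rw [abs_le]
      constructor <;> linarith [taperWeight_nonneg k (idxDist i j),
        taperWeight_le_one k (idxDist i j)]
    · rw [taperWeight_of_le_half (not_lt.1 h)]
      simp
  have hsym : ∀ i j, (taper k S - S) i j = (taper k S - S) j i := fun i j => by
    simpa using (((taper_isHermitian k hpd.1).sub hpd.1).apply i j).symm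
  refine l2_opNorm_le_of_sum_le _ (by positivity) (fun i => ?_) hcol
  simp_rw [hsym i]
  exact hcol i

end Taper

/-! ### Eigenvalue adjustment -/

section Adjust

variable {p : ℕ} {A : Matrix (Fin p) (Fin p) ℝ}

lemma dotProduct_adjust (ε : ℝ) (x : EuclideanSpace ℝ (Fin p)) :
    x.ofLp ⬝ᵥ (adjust ε A *ᵥ x.ofLp)
      = x.ofLp ⬝ᵥ (A *ᵥ x.ofLp) + max (ε - minEig A) 0 * ‖x‖ ^ 2 := by
  rw [adjust, Matrix.add_mulVec, Matrix.smul_mulVec, Matrix.one_mulVec, dotProduct_add,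
    dotProduct_smul, dotProduct_ofLp_self, smul_eq_mul]

lemma mul_le_dotProduct_adjust (hA : A.IsHermitian) (ε : ℝ) (x : EuclideanSpace ℝ (Fin p)) :
    ε * ‖x‖ ^ 2 ≤ x.ofLp ⬝ᵥ (adjust ε A *ᵥ x.ofLp) := by
  rw [dotProduct_adjust]
  have h1 := minEig_mul_le hA x
  have h2 := mul_le_mul_of_nonneg_right (le_max_left (ε - minEig A) 0) (sq_nonneg ‖x‖)
  linarith

lemma minEig_mul_le_dotProduct_adjust (hA : A.IsHermitian) (ε : ℝ) (x : EuclideanSpace ℝ (Fin p)) :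
    minEig A * ‖x‖ ^ 2 ≤ x.ofLp ⬝ᵥ (adjust ε A *ᵥ x.ofLp) := by
  rw [dotProduct_adjust]
  have h1 := minEig_mul_le hA x
  have h2 := mul_nonneg (le_max_right (ε - minEig A) 0) (sq_nonneg ‖x‖)
  linarith

lemma norm_sub_adjust_le [NeZero p] (B : Matrix (Fin p) (Fin p) ℝ) (ε : ℝ) :
    ‖B - adjust ε A‖ ≤ ‖B - A‖ + max (ε - minEig A) 0 := by
  have h : B - adjust ε A = (B - A) - max (ε - minEig A) 0 • (1 : Matrix (Fin p) (Fin p) ℝ) := by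
    rw [adjust]
    abel
  rw [h]
  refine (norm_sub_le _ _).trans ?_
  rw [norm_smul, Real.norm_of_nonneg (le_max_right _ _), norm_one, mul_one]

end Adjust

/-! ### Deterministic bound on the loss -/

lemma add_mul_add_le {a b c x y z r : ℝ} (ha : 0 ≤ a) (hb : 0 ≤ b) (hc : 0 ≤ c) (hx : 0 ≤ x)
    (hy : 0 ≤ y) (hz : 0 ≤ z) (hr : 0 ≤ r) :
    b * r + c * (z + r) ≤ (a + b + c) * (x + y + z + r) := by
  have e4 : 0 ≤ (a + b + c) * (x + y) := by positivity
  have e5 : 0 ≤ (a + b) * z := by positivity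
  have e6 : 0 ≤ a * r := by positivity
  linarith

/-- Large-error regime. After division by e a constant remains, and d > g/4 absorbs it through e² +
d²/e² ≥ 2d. -/
lemma sq_le_of_le_div {K g L d b e : ℝ} (hg : 0 < g) (he : 0 < e)
    (hL0 : 0 ≤ L) (hgd : g / 4 < d) (hL : L ≤ K * ((K + 2) * d + e) / e) :
    L ^ 2 ≤ (12 * K ^ 2 / g ^ 2 + 2 * K ^ 2 * (K + 2) ^ 2 + 4 * K ^ 2 / g)
      * (d ^ 2 + b ^ 2 + e ^ 2 + d ^ 2 / e ^ 2) := by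
  have hone : 1 ≤ 2 / g * (e ^ 2 + d ^ 2 / e ^ 2) := by
    have h2 : 2 * d ≤ e ^ 2 + d ^ 2 / e ^ 2 := by
      have h3 := sq_nonneg (e - d / e)
      have h4 : e * (d / e) = d := by field_simp
      have h5 : (d / e) ^ 2 = d ^ 2 / e ^ 2 := div_pow _ _ _
      nlinarith
    rw [div_mul_eq_mul_div, le_div_iff₀ hg]
    linarith
  have hr : (K * ((K + 2) * d + e) / e) ^ 2
      ≤ 2 * K ^ 2 * (K + 2) ^ 2 * (d ^ 2 / e ^ 2) + 2 * K ^ 2 * 1 := by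
    have h6 : K * ((K + 2) * d + e) / e = K * ((K + 2) * (d / e) + 1) := by field_simp
    rw [h6, ← div_pow]
    nlinarith [mul_nonneg (sq_nonneg K) (sq_nonneg ((K + 2) * (d / e) - 1))]
  have hA : 2 * K ^ 2 * 1 ≤ 2 * K ^ 2 * (2 / g * (e ^ 2 + d ^ 2 / e ^ 2)) := by gcongr
  have hsq : L ^ 2 ≤ (K * ((K + 2) * d + e) / e) ^ 2 := by gcongr
  have hB : 2 * K ^ 2 * (2 / g * (e ^ 2 + d ^ 2 / e ^ 2))
      = 4 * K ^ 2 / g * (e ^ 2 + d ^ 2 / e ^ 2) := by ring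
  have hC := add_mul_add_le (a := 12 * K ^ 2 / g ^ 2) (b := 2 * K ^ 2 * (K + 2) ^ 2)
    (c := 4 * K ^ 2 / g) (x := d ^ 2) (y := b ^ 2) (z := e ^ 2) (r := d ^ 2 / e ^ 2)
    (by positivity) (by positivity) (by positivity) (by positivity) (by positivity)
    (by positivity) (by positivity)
  linarith

lemma sq_le_of_le_const_mul {K g L d b e : ℝ} (hg : 0 < g)
    (hL0 : 0 ≤ L) (hL : L ≤ K * (d + b + e) / (g / 2)) :
    L ^ 2 ≤ (12 * K ^ 2 / g ^ 2 + 2 * K ^ 2 * (K + 2) ^ 2 + 4 * K ^ 2 / g)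
      * (d ^ 2 + b ^ 2 + e ^ 2 + 0) := by
  have h1 : L ^ 2 ≤ (K * (d + b + e) / (g / 2)) ^ 2 := by gcongr
  have h2 : (K * (d + b + e) / (g / 2)) ^ 2 = 4 * K ^ 2 / g ^ 2 * (d + b + e) ^ 2 := by
    field_simp
    ring
  have h3 : 4 * K ^ 2 / g ^ 2 * (d + b + e) ^ 2
      ≤ 4 * K ^ 2 / g ^ 2 * (3 * (d ^ 2 + b ^ 2 + e ^ 2)) := by
    gcongr
    nlinarith [sq_nonneg (d - b), sq_nonneg (d - e), sq_nonneg (b - e)]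
  have h4 : 0 ≤ (2 * K ^ 2 * (K + 2) ^ 2 + 4 * K ^ 2 / g) * (d ^ 2 + b ^ 2 + e ^ 2) := by
    positivity
  have h5 : 4 * K ^ 2 / g ^ 2 * (3 * (d ^ 2 + b ^ 2 + e ^ 2))
      = 12 * K ^ 2 / g ^ 2 * (d ^ 2 + b ^ 2 + e ^ 2) := by ring
  linarith

/-- Deterministic bound of the loss by the estimation error `‖T - T₀‖`, the bias `‖T₀ - S‖`, the
adjustment level `ε` and, only for large errors, the ratio of the error and `ε`. -/
lemma exists_norm_regCoef_sub_adjust_sq_le {M₀ M₁ : ℝ} (hM₀ : 0 < M₀) (hM₁ : 0 < M₁) :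
    ∃ C : ℝ, 0 < C ∧ ∀ (p₀ q : ℕ) [NeZero (p₀ + q)]
      (S T₀ T : Matrix (Fin (p₀ + q)) (Fin (p₀ + q)) ℝ) (ε : ℝ), 0 < ε →
      S.IsHermitian → T.IsHermitian → M₁ ≤ minEig S → ‖S‖ ≤ M₀ → ‖T₀ - S‖ ≤ minEig S / 4 →
      ‖regCoef S - regCoef (adjust ε T)‖ ^ 2 ≤
        C * (‖T - T₀‖ ^ 2 + ‖T₀ - S‖ ^ 2 + ε ^ 2
          + if M₁ / 4 < ‖T - T₀‖ then ‖T - T₀‖ ^ 2 / ε ^ 2 else 0) := by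
  set K : ℝ := 1 + M₀ / M₁ with hK
  have hK1 : 1 ≤ K := by
    rw [hK]
    have : 0 < M₀ / M₁ := by positivity
    linarith
  refine ⟨12 * K ^ 2 / M₁ ^ 2 + 2 * K ^ 2 * (K + 2) ^ 2 + 4 * K ^ 2 / M₁, by positivity, ?_⟩
  intro p₀ q _ S T₀ T ε hε hS hT h1 h0 hb
  set Δ := ‖T - T₀‖ with hΔ
  set b := ‖T₀ - S‖ with hbd
  set μ := minEig S with hμ
  have hΔ0 : 0 ≤ Δ := norm_nonneg _
  have hb0 : 0 ≤ b := norm_nonneg _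
  have hμM : μ ≤ M₀ := (minEig_le_norm hS).trans h0
  have hST : ‖S - T‖ ≤ Δ + b := by
    have h := norm_sub_le_norm_sub_add_norm_sub S T₀ T
    rw [norm_sub_rev S T₀, norm_sub_rev T₀ T] at h
    linarith
  have hmin : μ - (Δ + b) ≤ minEig T := by
    have := minEig_sub_le_minEig hS hT
    linarith
  have hadj := norm_sub_adjust_le (A := T) S ε
  have hSq : ∀ x : EuclideanSpace ℝ (Fin (p₀ + q)),
      M₁ * ‖x‖ ^ 2 ≤ x.ofLp ⬝ᵥ (S *ᵥ x.ofLp) := fun x =>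
    (mul_le_mul_of_nonneg_right h1 (sq_nonneg _)).trans (minEig_mul_le hS x)
  have hKS : 1 + ‖S‖ / M₁ ≤ K := by
    rw [hK]
    gcongr
  split_ifs with hlt
  -- Large error: b ≤ μ/4 gives `minEig T` ≥ −Δ, so the shift is at most ε + Δ.
  · have hτ : max (ε - minEig T) 0 ≤ ε + Δ := by
      rw [max_le_iff]
      constructor <;> linarith
    -- The bias is dominated by Δ here, so no ratio b/ε enters the bound.
    have hKΔ : b ≤ K * Δ := by
      have : b ≤ M₀ / M₁ * Δ := by
        calc b ≤ M₀ / 4 := by linarith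
          _ = M₀ / M₁ * (M₁ / 4) := by field_simp
          _ ≤ M₀ / M₁ * Δ := by gcongr
      rw [hK]
      linarith
    have hn := norm_regCoef_sub_le hM₁ hε hSq (mul_le_dotProduct_adjust hT ε)
    have hn2 : ‖regCoef S - regCoef (adjust ε T)‖ ≤ K * ((K + 2) * Δ + ε) / ε := by
      refine hn.trans ?_
      gcongr
      linarith
    exact sq_le_of_le_div hM₁ hε (norm_nonneg _) hlt hn2
  · push Not at hlt
    -- Small error: μ − μ/4 − M₁/4 ≥ M₁/2, so the coercivity does not depend on ε.
    have hm : M₁ / 2 ≤ minEig T := by linarith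
    have hτ : max (ε - minEig T) 0 ≤ ε := by
      rw [max_le_iff]
      constructor <;> linarith
    have hn := norm_regCoef_sub_le hM₁ (half_pos hM₁) hSq fun x =>
      (mul_le_mul_of_nonneg_right hm (sq_nonneg _)).trans (minEig_mul_le_dotProduct_adjust hT ε x)
    have hn2 : ‖regCoef S - regCoef (adjust ε T)‖ ≤ K * (Δ + b + ε) / (M₁ / 2) := by
      refine hn.trans ?_
      gcongr
      linarith
    exact sq_le_of_le_const_mul hM₁ (norm_nonneg _) hn2

/-! ### Continuity, hence measurability, of the loss -/

section Continuity

variable {n p₀ q p : ℕ}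

lemma sampleCov_isHermitian (z : Fin n → EuclideanSpace ℝ (Fin p)) :
    (sampleCov z).IsHermitian := by
  refine Matrix.IsHermitian.ext fun i j => ?_
  simp [sampleCov, Matrix.sum_apply, Matrix.vecMulVec_apply, mul_comm]

lemma continuous_taper_sampleCov (k : ℕ) :
    Continuous fun z : Fin n → EuclideanSpace ℝ (Fin p) => taper k (sampleCov z) := by
  refine continuous_matrix fun i j => ?_
  simp only [taper, sampleCov, Matrix.of_apply, Matrix.smul_apply, Matrix.sum_apply,
    Matrix.vecMulVec_apply]
  fun_prop

lemma continuous_minEig_comp [NeZero p] {X : Type*} [TopologicalSpace X]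
    {f : X → Matrix (Fin p) (Fin p) ℝ} (hf : Continuous f) (hh : ∀ x, (f x).IsHermitian) :
    Continuous fun x => minEig (f x) := by
  rw [continuous_iff_continuousAt]
  intro x
  refine tendsto_iff_norm_sub_tendsto_zero.2 ?_
  refine squeeze_zero (fun _ => norm_nonneg _) (fun y => ?_)
    (tendsto_iff_norm_sub_tendsto_zero.1 (hf.tendsto x))
  have h1 := minEig_sub_le_minEig (hh y) (hh x)
  have h2 := minEig_sub_le_minEig (hh x) (hh y)
  rw [norm_sub_rev] at h2
  rw [Real.norm_eq_abs, abs_le]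
  constructor <;> linarith

lemma continuous_taperLoss [NeZero (p₀ + q)] (k : ℕ) {ε : ℝ} (hε : 0 < ε)
    (S : Matrix (Fin (p₀ + q)) (Fin (p₀ + q)) ℝ) :
    Continuous (taperLoss (n := n) k ε S) := by
  have hh := fun z : Fin n → EuclideanSpace ℝ (Fin (p₀ + q)) =>
    taper_isHermitian k (sampleCov_isHermitian z)
  have hT := continuous_taper_sampleCov (n := n) (p := p₀ + q) k
  have hm := continuous_minEig_comp hT hh
  have hA : Continuous fun z : Fin n → EuclideanSpace ℝ (Fin (p₀ + q)) =>
      adjust ε (taper k (sampleCov z)) := by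
    unfold adjust
    exact hT.add (((continuous_const.sub hm).max continuous_const).smul continuous_const)
  have hX : Continuous fun z : Fin n → EuclideanSpace ℝ (Fin (p₀ + q)) =>
      blockXX (adjust ε (taper k (sampleCov z))) := hA.matrix_submatrix _ _
  have hY : Continuous fun z : Fin n → EuclideanSpace ℝ (Fin (p₀ + q)) =>
      blockYX (adjust ε (taper k (sampleCov z))) := hA.matrix_submatrix _ _
  have hI : Continuous fun z : Fin n → EuclideanSpace ℝ (Fin (p₀ + q)) =>
      (blockXX (adjust ε (taper k (sampleCov z))))⁻¹ := by
    simp_rw [Matrix.inv_def, Ring.inverse_eq_inv']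
    refine (hX.matrix_det.inv₀ fun z => ?_).smul hX.matrix_adjugate
    exact (isUnit_det_of_coercive _ hε
      (coercive_blockXX (mul_le_dotProduct_adjust (hh z) ε))).ne_zero
  unfold taperLoss regCoef
  exact ((continuous_const.sub (hY.matrix_mul hI)).norm).pow 2

end Continuity

/-! ### Nets of the unit ball and bilinear forms -/

section Net

variable {E : Type*} [NormedAddCommGroup E] [NormedSpace ℝ E] [FiniteDimensional ℝ E]

variable (E) in
/-- The unit ball of a finite-dimensional space has a `1 / 2`-net with at most `5 ^ dim` points. -/
lemma exists_half_net : ∃ N : Finset E, N.card ≤ 5 ^ Module.finrank ℝ E ∧ (∀ u ∈ N, ‖u‖ ≤ 1) ∧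
    ∀ x : E, ‖x‖ ≤ 1 → ∃ u ∈ N, ‖x - u‖ ≤ 1 / 2 := by
  classical
  set P : Finset E → Prop := fun s => (∀ c ∈ s, ‖c‖ ≤ 2) ∧
    ∀ c ∈ s, ∀ d ∈ s, c ≠ d → 1 ≤ ‖c - d‖ with hP
  set cards : Set ℕ := {m | ∃ s, P s ∧ s.card = m} with hcards
  have hbdd : BddAbove cards := ⟨5 ^ Module.finrank ℝ E, by
    rintro m ⟨s, hs, rfl⟩
    exact Besicovitch.card_le_of_separated s hs.1 hs.2⟩
  have hne : cards.Nonempty := ⟨0, ∅, by simp [hP], rfl⟩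
  -- A 1-separated subset of the ball of radius 2 with the most points; halved, it is the net, since
  -- an uncovered x would let 2x be added.
  obtain ⟨s, hs, hcard⟩ := Nat.sSup_mem hne hbdd
  refine ⟨s.image fun c => (1 / 2 : ℝ) • c,
    Finset.card_image_le.trans (Besicovitch.card_le_of_separated s hs.1 hs.2), ?_, ?_⟩
  · intro u hu
    obtain ⟨c, hc, rfl⟩ := Finset.mem_image.1 hu
    rw [norm_smul]
    have := hs.1 c hc
    norm_num
    linarith
  · intro x hx
    by_contra! hcon
    have hfar : ∀ c ∈ s, 1 ≤ ‖(2 : ℝ) • x - c‖ := fun c hc => by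
      have h1 := hcon _ (Finset.mem_image_of_mem _ hc)
      have h2 : x - (1 / 2 : ℝ) • c = (1 / 2 : ℝ) • ((2 : ℝ) • x - c) := by
        rw [smul_sub, smul_smul]
        norm_num
      rw [h2, norm_smul] at h1
      norm_num at h1
      linarith
    have hnot : (2 : ℝ) • x ∉ s := fun hmem => by
      have := hfar _ hmem
      simp at this
      linarith
    have hins : P (insert ((2 : ℝ) • x) s) := by
      refine ⟨fun c hc => ?_, fun c hc d hd hcd => ?_⟩
      · rcases Finset.mem_insert.1 hc with rfl | hc
        · rw [norm_smul]
          norm_num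
          linarith
        · exact hs.1 c hc
      · rcases Finset.mem_insert.1 hc with rfl | hc <;> rcases Finset.mem_insert.1 hd with rfl | hd
        · exact absurd rfl hcd
        · exact hfar d hd
        · rw [norm_sub_rev]
          exact hfar c hc
        · exact hs.2 c hc d hd hcd
    have := le_csSup hbdd ⟨_, hins, rfl⟩
    rw [Finset.card_insert_of_notMem hnot, ← hcard] at this
    omega

/-- Approximating a unit vector by the net gives ‖f‖ ≤ t + ‖f‖/2. -/
lemma abs_le_of_half_net {N : Finset E} (hN : ∀ x : E, ‖x‖ ≤ 1 → ∃ u ∈ N, ‖x - u‖ ≤ 1 / 2)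
    (f : E →ₗ[ℝ] ℝ) {t : ℝ} (ht : 0 ≤ t) (h : ∀ u ∈ N, |f u| ≤ t) (x : E) :
    |f x| ≤ 2 * t * ‖x‖ := by
  set g := LinearMap.toContinuousLinearMap f with hg
  have h1 : ‖g‖ ≤ t + ‖g‖ / 2 := by
    refine ContinuousLinearMap.opNorm_le_of_unit_norm (by positivity) fun y hy => ?_
    obtain ⟨u, hu, hyu⟩ := hN y hy.le
    have h2 : g y = f u + g (y - u) := by
      rw [map_sub]
      simp [hg]
    have h3 : ‖g (y - u)‖ ≤ ‖g‖ * (1 / 2) := (g.le_opNorm _).trans (by gcongr)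
    rw [h2]
    refine (norm_add_le _ _).trans ?_
    have := h u hu
    rw [Real.norm_eq_abs]
    linarith
  calc |f x| = ‖g x‖ := by simp [hg]
    _ ≤ ‖g‖ * ‖x‖ := g.le_opNorm x
    _ ≤ 2 * t * ‖x‖ := by
      gcongr
      linarith

lemma abs_bilin_le_of_half_net {N : Finset E}
    (hN : ∀ x : E, ‖x‖ ≤ 1 → ∃ u ∈ N, ‖x - u‖ ≤ 1 / 2)
    (B : E →ₗ[ℝ] E →ₗ[ℝ] ℝ) {t : ℝ} (ht : 0 ≤ t) (h : ∀ u ∈ N, ∀ v ∈ N, |B u v| ≤ t) (x y : E) :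
    |B x y| ≤ 4 * t * ‖x‖ * ‖y‖ := by
  have h1 : ∀ u ∈ N, |B u y| ≤ 2 * t * ‖y‖ := fun u hu =>
    abs_le_of_half_net hN (B u) ht (h u hu) y
  have h2 := abs_le_of_half_net hN (B.flip y) (t := 2 * t * ‖y‖) (by positivity) h1 x
  rw [LinearMap.flip_apply] at h2
  linarith

end Net

/-! ### Tapering as an average over sliding windows -/

section BlockDecomposition

variable {p : ℕ}

/-- Vectors supported on the indices `i` with `l - k ≤ i < l`. -/
def windowSpace (p k l : ℕ) : Submodule ℝ (EuclideanSpace ℝ (Fin p)) where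
  carrier := {x | ∀ i : Fin p, ¬ ((i : ℕ) < l ∧ l ≤ i + k) → x i = 0}
  add_mem' := fun {x y} hx hy i hi => by simp [hx i hi, hy i hi]
  zero_mem' := fun i _ => rfl
  smul_mem' := fun c x hx i hi => by simp [hx i hi]

lemma finrank_windowSpace_le (p k l : ℕ) : Module.finrank ℝ (windowSpace p k l) ≤ k := by
  -- Slot a reads coordinate l − k + a; windows may overhang either end of the index range, where
  -- the value is 0.
  let f : windowSpace p k l →ₗ[ℝ] (Fin k → ℝ) :=
    { toFun := fun x a => if h : k ≤ a + l ∧ a + l - k < p then x.1 ⟨a + l - k, h.2⟩ else 0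
      map_add' := fun x y => by
        ext a
        simp only [Pi.add_apply]
        split_ifs <;> simp
      map_smul' := fun c x => by
        ext a
        simp only [Pi.smul_apply, RingHom.id_apply]
        split_ifs <;> simp }
  have hf : Function.Injective f := by
    refine (injective_iff_map_eq_zero f).2 fun x hx => ?_
    refine Subtype.ext (PiLp.ext fun i => ?_)
    by_cases hi : (i : ℕ) < l ∧ l ≤ i + k
    · have h1 := congrFun hx ⟨i + k - l, by omega⟩
      have h2 : k ≤ i + k - l + l ∧ i + k - l + l - k < p := by
        have := i.2
        omega
      have h3 : (⟨i + k - l + l - k, h2.2⟩ : Fin p) = i := Fin.ext (by simp only; omega)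
      simp only [f, LinearMap.coe_mk, AddHom.coe_mk, h2, and_self, dite_true, h3] at h1
      exact h1
    · exact x.2 i hi
  simpa using LinearMap.finrank_le_finrank_of_injective hf

/-- Restriction of a vector to the indices `i` with `l - m ≤ i < l`. -/
noncomputable def window (m l : ℕ) (x : EuclideanSpace ℝ (Fin p)) : EuclideanSpace ℝ (Fin p) :=
  WithLp.toLp 2 fun i => if (i : ℕ) < l ∧ l ≤ i + m then x i else 0

lemma window_mem {m k : ℕ} (hmk : m ≤ k) (l : ℕ) (x : EuclideanSpace ℝ (Fin p)) :
    window m l x ∈ windowSpace p k l := fun i hi => by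
  have : ¬ ((i : ℕ) < l ∧ l ≤ i + m) := fun h => hi ⟨h.1, by omega⟩
  simp [window, this]

/-- The truncated subtraction is the triangular weight. The range p + k contains every relevant l
for all m ≤ k, so one family of positions serves all window lengths. -/
lemma card_windows (m k : ℕ) (hmk : m ≤ k) (i j : Fin p) :
    ((Finset.range (p + k)).filter fun l =>
      ((i : ℕ) < l ∧ l ≤ i + m) ∧ ((j : ℕ) < l ∧ l ≤ j + m)).card = m - idxDist i j := by
  have h : ((Finset.range (p + k)).filter fun l =>
      ((i : ℕ) < l ∧ l ≤ i + m) ∧ ((j : ℕ) < l ∧ l ≤ j + m))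
      = Finset.Ioc (max (i : ℕ) j) (min (i : ℕ) j + m) := by
    ext l
    simp only [Finset.mem_filter, Finset.mem_range, Finset.mem_Ioc]
    have := i.2
    have := j.2
    omega
  rw [h, Nat.card_Ioc]
  unfold idxDist
  omega

lemma sum_window_bilin (A : Matrix (Fin p) (Fin p) ℝ) {m k : ℕ} (hmk : m ≤ k)
    (x y : EuclideanSpace ℝ (Fin p)) :
    ∑ l ∈ Finset.range (p + k), (window m l x).ofLp ⬝ᵥ (A *ᵥ (window m l y).ofLp)
      = ∑ i : Fin p, ∑ j : Fin p, ((m - idxDist i j : ℕ) : ℝ) * (x i * (A i j * y j)) := by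
  have h1 : ∀ l, (window m l x).ofLp ⬝ᵥ (A *ᵥ (window m l y).ofLp)
      = ∑ i : Fin p, ∑ j : Fin p, if ((i : ℕ) < l ∧ l ≤ i + m) ∧ ((j : ℕ) < l ∧ l ≤ j + m)
          then x i * (A i j * y j) else 0 := fun l => by
    simp only [dotProduct, Matrix.mulVec, window, Finset.mul_sum]
    refine Finset.sum_congr rfl fun i _ => Finset.sum_congr rfl fun j _ => ?_
    by_cases hi : (i : ℕ) < l ∧ l ≤ i + m <;> by_cases hj : (j : ℕ) < l ∧ l ≤ j + m <;>
      simp [hi, hj]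
  simp_rw [h1]
  rw [Finset.sum_comm]
  refine Finset.sum_congr rfl fun i _ => ?_
  rw [Finset.sum_comm]
  refine Finset.sum_congr rfl fun j _ => ?_
  rw [← Finset.sum_filter, Finset.sum_const, card_windows m k hmk, nsmul_eq_mul]

lemma sum_norm_window_sq {m k : ℕ} (hmk : m ≤ k) (x : EuclideanSpace ℝ (Fin p)) :
    ∑ l ∈ Finset.range (p + k), ‖window m l x‖ ^ 2 = m * ‖x‖ ^ 2 := by
  have h := sum_window_bilin (1 : Matrix (Fin p) (Fin p) ℝ) hmk x x
  simp only [Matrix.one_mulVec, dotProduct_ofLp_self] at h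
  rw [h, EuclideanSpace.real_norm_sq_eq, Finset.mul_sum]
  refine Finset.sum_congr rfl fun i _ => ?_
  rw [Finset.sum_eq_single i]
  · simp [idxDist, sq]
  · intro j _ hj
    simp [Matrix.one_apply_ne hj.symm]
  · simp

/-- The tapering weight as a combination of three triangular weights. -/
lemma mul_taperWeight (k d : ℕ) (hk : 0 < k) : (k : ℝ) * taperWeight k d
    = 2 * ((k - d : ℕ) : ℝ) - ((k / 2 - d : ℕ) : ℝ) - (((k + 1) / 2 - d : ℕ) : ℝ) := by
  have hk0 : (k : ℝ) ≠ 0 := by positivity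
  have hsum : k / 2 + (k + 1) / 2 = k := by omega
  have hsum' : ((k / 2 : ℕ) : ℝ) + (((k + 1) / 2 : ℕ) : ℝ) = k := by exact_mod_cast hsum
  by_cases h1 : d ≤ k / 2
  · rw [taperWeight_of_le_half h1, Nat.cast_sub (by omega), Nat.cast_sub h1,
      Nat.cast_sub (by omega)]
    linarith
  · have h2 : ¬ (d : ℝ) ≤ (k : ℝ) / 2 := by
      rw [le_div_iff₀ two_pos]
      norm_cast
      omega
    rw [Nat.sub_eq_zero_of_le (by omega : k / 2 ≤ d),
      Nat.sub_eq_zero_of_le (by omega : (k + 1) / 2 ≤ d)]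
    by_cases h3 : d < k
    · rw [taperWeight, if_neg h2, if_pos h3, Nat.cast_sub h3.le]
      field_simp
      simp
    · rw [taperWeight, if_neg h2, if_neg h3, Nat.sub_eq_zero_of_le (by omega)]
      simp

/-- By `mul_taperWeight`, k times the tapered form is twice the window sum of length k minus those
of lengths ⌊k/2⌋ and ⌈k/2⌉. Each sum of length m is at most m·t·r, and 2k + ⌊k/2⌋ + ⌈k/2⌉ = 3k. -/
lemma norm_taper_le (A : Matrix (Fin p) (Fin p) ℝ) {k : ℕ} (hk : 0 < k) {t : ℝ} (ht : 0 ≤ t)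
    (h : ∀ l ∈ Finset.range (p + k), ∀ x ∈ windowSpace p k l, ∀ y ∈ windowSpace p k l,
      |x.ofLp ⬝ᵥ (A *ᵥ y.ofLp)| ≤ t * ‖x‖ * ‖y‖) : ‖taper k A‖ ≤ 3 * t := by
  refine l2_opNorm_le_of_dotProduct_le _ (by positivity) fun x y => ?_
  set r := (‖x‖ ^ 2 + ‖y‖ ^ 2) / 2 with hr
  have hB : ∀ m ≤ k, |∑ i : Fin p, ∑ j : Fin p,
        ((m - idxDist i j : ℕ) : ℝ) * (x i * (A i j * y j))|
      ≤ m * (t * r) := fun m hm => by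
    rw [← sum_window_bilin A hm x y]
    calc _ ≤ ∑ l ∈ Finset.range (p + k),
            |(window m l x).ofLp ⬝ᵥ (A *ᵥ (window m l y).ofLp)| := Finset.abs_sum_le_sum_abs _ _
      _ ≤ ∑ l ∈ Finset.range (p + k), t / 2 * (‖window m l x‖ ^ 2 + ‖window m l y‖ ^ 2) := by
          refine Finset.sum_le_sum fun l hl => ?_
          refine (h l hl _ (window_mem hm l x) _ (window_mem hm l y)).trans ?_
          nlinarith [mul_nonneg ht (sq_nonneg (‖window m l x‖ - ‖window m l y‖))]
      _ = _ := by
          rw [← Finset.mul_sum, Finset.sum_add_distrib, sum_norm_window_sq hm,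
            sum_norm_window_sq hm, hr]
          ring
  have e : (k : ℝ) * (x.ofLp ⬝ᵥ (taper k A *ᵥ y.ofLp))
      = 2 * ∑ i : Fin p, ∑ j : Fin p, ((k - idxDist i j : ℕ) : ℝ) * (x i * (A i j * y j))
        - ∑ i : Fin p, ∑ j : Fin p, ((k / 2 - idxDist i j : ℕ) : ℝ) * (x i * (A i j * y j))
        - ∑ i : Fin p, ∑ j : Fin p, (((k + 1) / 2 - idxDist i j : ℕ) : ℝ) * (x i * (A i j * y j)) := by
    simp only [dotProduct, Matrix.mulVec, Finset.mul_sum, ← Finset.sum_sub_distrib]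
    refine Finset.sum_congr rfl fun i _ => Finset.sum_congr rfl fun j _ => ?_
    have := mul_taperWeight k (idxDist i j) hk
    simp only [taper, Matrix.of_apply]
    linear_combination (x i * (A i j * y j)) * this
  have b1 := (abs_le.1 (hB k le_rfl)).2
  have b2 := (abs_le.1 (hB (k / 2) (by omega))).1
  have b3 := (abs_le.1 (hB ((k + 1) / 2) (by omega))).1
  have hsum : ((k / 2 : ℕ) : ℝ) + (((k + 1) / 2 : ℕ) : ℝ) = k := by
    have : k / 2 + (k + 1) / 2 = k := by omega
    exact_mod_cast this
  have hk0 : (0 : ℝ) < k := by exact_mod_cast hk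
  refine le_of_mul_le_mul_left ?_ hk0
  rw [e]
  have hs2 : ((k / 2 : ℕ) : ℝ) * (t * r) + (((k + 1) / 2 : ℕ) : ℝ) * (t * r) = k * (t * r) := by
    rw [← add_mul, hsum]
  linarith

/-- A finite set of test vectors whose quadratic forms control the norm of every tapered
symmetric matrix. -/
lemma exists_taper_test_vectors (p : ℕ) {k : ℕ} (hk : 0 < k) :
    ∃ N : Finset (EuclideanSpace ℝ (Fin p)), N.card ≤ (p + k) * (2 * 25 ^ k) + 1 ∧
      (∀ w ∈ N, ‖w‖ ≤ 1) ∧ ∀ D : Matrix (Fin p) (Fin p) ℝ, D.IsHermitian →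
        ∃ w ∈ N, ‖taper k D‖ ≤ 24 * |w.ofLp ⬝ᵥ (D *ᵥ w.ofLp)| := by
  classical
  -- Pairs from a net of at most 5^k points number at most 25^k; each pair contributes its half sum
  -- and half difference. The vector 0 is added to ensure nonemptiness.
  choose N hcard hN1 hN using fun l => exists_half_net (windowSpace p k l)
  let plus : ∀ l, windowSpace p k l × windowSpace p k l → EuclideanSpace ℝ (Fin p) :=
    fun l uv => (1 / 2 : ℝ) • (uv.1.1 + uv.2.1)
  let minus : ∀ l, windowSpace p k l × windowSpace p k l → EuclideanSpace ℝ (Fin p) :=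
    fun l uv => (1 / 2 : ℝ) • (uv.1.1 - uv.2.1)
  let Q : ℕ → Finset (EuclideanSpace ℝ (Fin p)) := fun l =>
    (N l ×ˢ N l).image (plus l) ∪ (N l ×ˢ N l).image (minus l)
  have hQ : ∀ l, (Q l).card ≤ 2 * 25 ^ k := fun l => by
    have h1 : (N l ×ˢ N l).card ≤ 25 ^ k := by
      rw [Finset.card_product, show (25 : ℕ) = 5 * 5 from rfl, mul_pow]
      have : (N l).card ≤ 5 ^ k :=
        (hcard l).trans (Nat.pow_le_pow_right (by norm_num) (finrank_windowSpace_le p k l))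
      exact Nat.mul_le_mul this this
    refine (Finset.card_union_le _ _).trans ?_
    have h2 := (Finset.card_image_le (s := N l ×ˢ N l) (f := plus l)).trans h1
    have h3 := (Finset.card_image_le (s := N l ×ˢ N l) (f := minus l)).trans h1
    omega
  refine ⟨insert 0 ((Finset.range (p + k)).biUnion Q), ?_, ?_, ?_⟩
  · refine (Finset.card_insert_le _ _).trans (Nat.add_le_add_right ?_ 1)
    refine (Finset.card_biUnion_le_card_mul _ _ _ fun l _ => hQ l).trans ?_
    rw [Finset.card_range]
  · intro w hw
    rcases Finset.mem_insert.1 hw with rfl | hw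
    · simp
    obtain ⟨l, -, hl⟩ := Finset.mem_biUnion.1 hw
    rcases Finset.mem_union.1 hl with hl | hl <;> obtain ⟨⟨u, v⟩, huv, rfl⟩ := Finset.mem_image.1 hl
    all_goals
      have hu : ‖u.1‖ ≤ 1 := hN1 l u (Finset.mem_product.1 huv).1
      have hv : ‖v.1‖ ≤ 1 := hN1 l v (Finset.mem_product.1 huv).2
    · have := norm_add_le u.1 v.1
      simp only [plus, norm_smul]
      norm_num
      linarith
    · have := norm_sub_le u.1 v.1
      simp only [minus, norm_smul]
      norm_num
      linarith
  · intro D hD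
    obtain ⟨w, hw, hmax⟩ := Finset.exists_max_image (insert 0 ((Finset.range (p + k)).biUnion Q))
      (fun w => |w.ofLp ⬝ᵥ (D *ᵥ w.ofLp)|) (Finset.insert_nonempty _ _)
    refine ⟨w, hw, ?_⟩
    set t := |w.ofLp ⬝ᵥ (D *ᵥ w.ofLp)| with ht
    have ht0 : 0 ≤ t := abs_nonneg _
    -- Origin of 24: polarization gives |uᵀDv| ≤ 2t on net pairs, passing from nets to all vectors
    -- costs 4, and the window decomposition costs 3.
    have key := norm_taper_le D hk (t := 4 * (2 * t)) (by positivity) fun l hl x hx y hy => by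
      let B : windowSpace p k l →ₗ[ℝ] windowSpace p k l →ₗ[ℝ] ℝ :=
        LinearMap.mk₂ ℝ (fun x y => x.1.ofLp ⬝ᵥ (D *ᵥ y.1.ofLp))
          (fun x x' y => by simp [add_dotProduct]) (fun c x y => by simp [smul_dotProduct])
          (fun x y y' => by simp [Matrix.mulVec_add]) (fun c x y => by simp [Matrix.mulVec_smul])
      refine abs_bilin_le_of_half_net (hN l) B (by positivity) (fun u hu v hv => ?_)
        ⟨x, hx⟩ ⟨y, hy⟩
      have huv : (u, v) ∈ N l ×ˢ N l := Finset.mem_product.2 ⟨hu, hv⟩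
      have m1 : plus l (u, v) ∈ insert 0 ((Finset.range (p + k)).biUnion Q) :=
        Finset.mem_insert_of_mem (Finset.mem_biUnion.2
          ⟨l, hl, Finset.mem_union_left _ (Finset.mem_image_of_mem _ huv)⟩)
      have m2 : minus l (u, v) ∈ insert 0 ((Finset.range (p + k)).biUnion Q) :=
        Finset.mem_insert_of_mem (Finset.mem_biUnion.2
          ⟨l, hl, Finset.mem_union_right _ (Finset.mem_image_of_mem _ huv)⟩)
      have i1 := hmax _ m1
      have i2 := hmax _ m2
      have hs : v.1.ofLp ⬝ᵥ (D *ᵥ u.1.ofLp) = u.1.ofLp ⬝ᵥ (D *ᵥ v.1.ofLp) := by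
        have : Dᵀ = D := by
          simpa [Matrix.IsHermitian, Matrix.conjTranspose_eq_transpose_of_trivial] using hD
        rw [Matrix.dotProduct_mulVec, ← Matrix.mulVec_transpose, this, dotProduct_comm]
      have hpol : u.1.ofLp ⬝ᵥ (D *ᵥ v.1.ofLp)
          = (plus l (u, v)).ofLp ⬝ᵥ (D *ᵥ (plus l (u, v)).ofLp)
            - (minus l (u, v)).ofLp ⬝ᵥ (D *ᵥ (minus l (u, v)).ofLp) := by
        simp only [plus, minus, WithLp.ofLp_smul, WithLp.ofLp_add, WithLp.ofLp_sub,
          Matrix.mulVec_add, Matrix.mulVec_sub, Matrix.mulVec_smul, add_dotProduct, sub_dotProduct,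
          dotProduct_add, dotProduct_sub, smul_dotProduct, dotProduct_smul, smul_eq_mul, hs]
        ring
      change |u.1.ofLp ⬝ᵥ (D *ᵥ v.1.ofLp)| ≤ 2 * t
      rw [hpol]
      refine (abs_sub _ _).trans ?_
      linarith
    linarith

end BlockDecomposition

/-! ### Exponential moments of a centred squared Gaussian -/

section ChiSquare

lemma inv_one_sub_le_exp {y : ℝ} (h : |y| ≤ 1 / 2) : 1 / (1 - y) ≤ Real.exp (y + y ^ 2) := by
  rw [abs_le] at h
  have h1 : 0 < 1 - y := by linarith
  rw [div_le_iff₀ h1]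
  rcases le_total y 0 with hy | hy
  · have h2 := Real.add_one_le_exp (y + y ^ 2)
    have h3 : 1 ≤ (y + y ^ 2 + 1) * (1 - y) := by
      have : 0 ≤ -y * y ^ 2 := mul_nonneg (by linarith) (sq_nonneg y)
      nlinarith
    exact h3.trans (mul_le_mul_of_nonneg_right h2 h1.le)
  · have h2 := Real.quadratic_le_exp_of_nonneg (by positivity : 0 ≤ y + y ^ 2)
    have h3 : 1 ≤ (1 + (y + y ^ 2) + (y + y ^ 2) ^ 2 / 2) * (1 - y) := by
      have e : (1 + (y + y ^ 2) + (y + y ^ 2) ^ 2 / 2) * (1 - y)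
          = 1 + y ^ 2 * (1 - y - y ^ 2 - y ^ 3) / 2 := by ring
      rw [e]
      have : 0 ≤ 1 - y - y ^ 2 - y ^ 3 := by nlinarith [sq_nonneg y, mul_nonneg hy (sq_nonneg y)]
      have := mul_nonneg (sq_nonneg y) this
      linarith
    exact h3.trans (mul_le_mul_of_nonneg_right h2 h1.le)

/-- For v > 0 the integral equals exp(−sv)/√(1 − 2sv), and `inv_one_sub_le_exp` with y = 2sv leaves
only the quadratic term. For v = 0 the law is a Dirac mass. -/
lemma integrable_and_integral_exp_sq_sub_le (v : NNReal) {s : ℝ} (hs : |s| * v ≤ 1 / 4) :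
    Integrable (fun x : ℝ => Real.exp (s * (x ^ 2 - v))) (gaussianReal 0 v) ∧
      ∫ x, Real.exp (s * (x ^ 2 - v)) ∂(gaussianReal 0 v) ≤ Real.exp (2 * s ^ 2 * v ^ 2) := by
  by_cases hv : v = 0
  · subst hv
    rw [gaussianReal_zero_var]
    refine ⟨integrable_dirac (by simp), ?_⟩
    simp
  have hv0 : (0 : ℝ) < v := by positivity
  set b : ℝ := 1 / (2 * v) - s with hb
  have hsv : |2 * s * v| ≤ 1 / 2 := by
    rw [abs_mul, abs_mul, abs_two, abs_of_pos hv0]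
    linarith
  have hb0 : 0 < 1 - 2 * s * v := by
    have := (abs_le.1 hsv).2
    linarith
  have hbv : b = (1 - 2 * s * v) / (2 * v) := by
    rw [hb]
    field_simp
  have hbpos : 0 < b := by
    rw [hbv]
    positivity
  have hfun : ∀ x : ℝ, gaussianPDFReal 0 v x * Real.exp (s * (x ^ 2 - v))
      = (√(2 * Real.pi * v))⁻¹ * Real.exp (-(s * v)) * Real.exp (-b * x ^ 2) := fun x => by
    rw [gaussianPDFReal_def, mul_assoc (√(2 * Real.pi * v))⁻¹, mul_assoc (√(2 * Real.pi * v))⁻¹,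
      ← Real.exp_add, ← Real.exp_add]
    congr 2
    rw [hb]
    field_simp
    ring
  constructor
  · rw [gaussianReal_of_var_ne_zero _ hv,
      integrable_withDensity_iff_integrable_smul₀' (measurable_gaussianPDF _ _).aemeasurable
        (ae_of_all _ fun _ => gaussianPDF_lt_top)]
    simp only [toReal_gaussianPDF, smul_eq_mul, hfun]
    exact (integrable_exp_neg_mul_sq hbpos).const_mul _
  · rw [integral_gaussianReal_eq_integral_smul hv]
    simp only [smul_eq_mul, hfun]
    rw [integral_const_mul, integral_gaussian]
    have h1 : (√(2 * Real.pi * v))⁻¹ * Real.exp (-(s * v)) * √(Real.pi / b)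
        = √(1 / (1 - 2 * s * v)) * Real.exp (-(s * v)) := by
      rw [mul_right_comm, ← Real.sqrt_inv, ← Real.sqrt_mul (by positivity), hbv]
      congr 2
      field_simp
    have h2 : √(1 / (1 - 2 * s * v)) ≤ Real.exp (s * v + 2 * s ^ 2 * v ^ 2) := by
      rw [Real.sqrt_le_left (Real.exp_pos _).le, ← Real.exp_nat_mul]
      refine (inv_one_sub_le_exp hsv).trans (le_of_eq ?_)
      push_cast
      ring_nf
    rw [h1]
    calc _ ≤ Real.exp (s * v + 2 * s ^ 2 * v ^ 2) * Real.exp (-(s * v)) := by gcongr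
      _ = _ := by
        rw [← Real.exp_add]
        ring_nf

end ChiSquare

/-! ### Exponential moments for the sample covariance -/

section SampleCovariance

variable {n p : ℕ} {S : Matrix (Fin p) (Fin p) ℝ}

lemma map_dotProduct_multivariateGaussian (hS : S.PosSemidef) (w : EuclideanSpace ℝ (Fin p)) :
    (multivariateGaussian 0 S).map (fun z => w.ofLp ⬝ᵥ z.ofLp)
      = gaussianReal 0 (w.ofLp ⬝ᵥ (S *ᵥ w.ofLp)).toNNReal := by
  have h := IsGaussian.map_eq_gaussianReal (μ := multivariateGaussian 0 S) (innerSL ℝ w)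
  have hf : (fun z : EuclideanSpace ℝ (Fin p) => w.ofLp ⬝ᵥ z.ofLp) = innerSL ℝ w := by
    ext z
    rw [innerSL_apply_apply, EuclideanSpace.inner_eq_star_dotProduct, star_trivial,
      dotProduct_comm]
  have hm : ∫ x, innerSL ℝ w x ∂(multivariateGaussian 0 S) = 0 := by
    rw [(innerSL ℝ w).integral_comp_id_comm IsGaussian.integrable_id,
      integral_id_multivariateGaussian, map_zero]
  have hv : Var[innerSL ℝ w; multivariateGaussian 0 S] = w.ofLp ⬝ᵥ (S *ᵥ w.ofLp) := by
    rw [← covarianceBilin_multivariateGaussian (μ := 0) hS w w,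
      covarianceBilin_self IsGaussian.memLp_two_id]
    rfl
  rw [hf, h, hm, hv]

lemma dotProduct_sampleCov_sub (hn : 0 < n) (z : Fin n → EuclideanSpace ℝ (Fin p))
    (w : EuclideanSpace ℝ (Fin p)) :
    w.ofLp ⬝ᵥ ((sampleCov z - S) *ᵥ w.ofLp)
      = (n : ℝ)⁻¹ * ∑ i, ((w.ofLp ⬝ᵥ (z i).ofLp) ^ 2 - w.ofLp ⬝ᵥ (S *ᵥ w.ofLp)) := by
  have hn0 : (n : ℝ) ≠ 0 := by positivity
  rw [Matrix.sub_mulVec, dotProduct_sub, sampleCov, Matrix.smul_mulVec, dotProduct_smul,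
    Matrix.sum_mulVec, dotProduct_sum, Finset.sum_sub_distrib, mul_sub, smul_eq_mul]
  congr 1
  · congr 1
    refine Finset.sum_congr rfl fun i _ => ?_
    rw [Matrix.vecMulVec_mulVec, sq]
    simp [dotProduct_comm]
  · simp [hn0]

/-- Independence factorizes the exponential into n equal moments with parameter s = θ/n, and n·2s²v²
= 2θ²v²/n. -/
lemma integrable_and_integral_exp_quadratic_le (hn : 0 < n) (hS : S.PosSemidef) {M₀ θ : ℝ}
    {w : EuclideanSpace ℝ (Fin p)} (hw : w.ofLp ⬝ᵥ (S *ᵥ w.ofLp) ≤ M₀)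
    (hθ : |θ| * M₀ ≤ n / 4) :
    Integrable (fun z : Fin n → EuclideanSpace ℝ (Fin p) =>
        Real.exp (θ * (w.ofLp ⬝ᵥ ((sampleCov z - S) *ᵥ w.ofLp))))
      (Measure.pi fun _ => multivariateGaussian 0 S) ∧
    ∫ z : Fin n → EuclideanSpace ℝ (Fin p),
        Real.exp (θ * (w.ofLp ⬝ᵥ ((sampleCov z - S) *ᵥ w.ofLp)))
      ∂(Measure.pi fun _ => multivariateGaussian 0 S) ≤ Real.exp (2 * θ ^ 2 * M₀ ^ 2 / n) := by
  have hn0 : (0 : ℝ) < n := by exact_mod_cast hn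
  set v := w.ofLp ⬝ᵥ (S *ᵥ w.ofLp) with hv
  have hv0 : 0 ≤ v := by simpa using hS.dotProduct_mulVec_nonneg w.ofLp
  have hvc : (v.toNNReal : ℝ) = v := Real.coe_toNNReal _ hv0
  set s := θ / n with hs
  have hsv : |s| * (v.toNNReal : ℝ) ≤ 1 / 4 := by
    rw [hvc, hs, abs_div, abs_of_pos hn0, div_mul_eq_mul_div, div_le_iff₀ hn0]
    calc |θ| * v ≤ |θ| * M₀ := by gcongr
      _ ≤ n / 4 := hθ
      _ = _ := by ring
  obtain ⟨hint, hle⟩ := integrable_and_integral_exp_sq_sub_le v.toNNReal hsv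
  rw [hvc] at hint hle
  have hmeas : Measurable fun z : EuclideanSpace ℝ (Fin p) => w.ofLp ⬝ᵥ z.ofLp := by
    unfold dotProduct
    fun_prop
  rw [← map_dotProduct_multivariateGaussian hS w] at hint hle
  have haesm : AEStronglyMeasurable (fun x : ℝ => Real.exp (s * (x ^ 2 - v)))
      ((multivariateGaussian 0 S).map fun z => w.ofLp ⬝ᵥ z.ofLp) := by fun_prop
  have hint' := (integrable_map_measure haesm hmeas.aemeasurable).1 hint
  rw [integral_map hmeas.aemeasurable haesm] at hle
  have hfun : ∀ z : Fin n → EuclideanSpace ℝ (Fin p),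
      Real.exp (θ * (w.ofLp ⬝ᵥ ((sampleCov z - S) *ᵥ w.ofLp)))
        = ∏ i, Real.exp (s * ((w.ofLp ⬝ᵥ (z i).ofLp) ^ 2 - v)) := fun z => by
    rw [dotProduct_sampleCov_sub hn, ← Real.exp_sum, ← Finset.mul_sum, hs]
    congr 1
    ring
  simp_rw [hfun]
  constructor
  · exact Integrable.fintype_prod (fun _ => hint')
  · rw [integral_fintype_prod_eq_prod
      (f := fun _ (z : EuclideanSpace ℝ (Fin p)) => Real.exp (s * ((w.ofLp ⬝ᵥ z.ofLp) ^ 2 - v)))]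
    rw [Finset.prod_const, Finset.card_univ, Fintype.card_fin]
    calc _ ≤ Real.exp (2 * s ^ 2 * v ^ 2) ^ n :=
          pow_le_pow_left₀ (integral_nonneg fun _ => (Real.exp_pos _).le) hle n
      _ = Real.exp (2 * θ ^ 2 * v ^ 2 / n) := by
          rw [← Real.exp_nat_mul, hs]
          congr 1
          field_simp
      _ ≤ _ := by gcongr

lemma exp_mul_abs_le (θ x : ℝ) : Real.exp (θ * |x|) ≤ Real.exp (θ * x) + Real.exp (-θ * x) := by
  rcases abs_cases x with ⟨h, -⟩ | ⟨h, -⟩ <;> rw [h]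
  · linarith [Real.exp_pos (-θ * x)]
  · rw [mul_neg, ← neg_mul]
    linarith [Real.exp_pos (θ * x)]

lemma continuous_norm_taper_sampleCov_sub (k : ℕ) (S : Matrix (Fin p) (Fin p) ℝ) :
    Continuous fun z : Fin n → EuclideanSpace ℝ (Fin p) => ‖taper k (sampleCov z - S)‖ := by
  simp_rw [taper_sub]
  exact ((continuous_taper_sampleCov k).sub continuous_const).norm

/-- Exponential moments of the deviation of the tapered sample covariance matrix. -/
lemma integrable_and_integral_exp_norm_taper_le (hn : 0 < n) (hS : S.PosSemidef) {k : ℕ}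
    (hk : 0 < k) {M₀ θ : ℝ} (hM₀ : 0 ≤ M₀)
    (hw : ∀ w : EuclideanSpace ℝ (Fin p), w.ofLp ⬝ᵥ (S *ᵥ w.ofLp) ≤ M₀ * ‖w‖ ^ 2)
    (hθ0 : 0 ≤ θ) (hθ : 96 * θ * M₀ ≤ n) :
    Integrable (fun z : Fin n → EuclideanSpace ℝ (Fin p) =>
        Real.exp (θ * ‖taper k (sampleCov z - S)‖))
      (Measure.pi fun _ => multivariateGaussian 0 S) ∧
    ∫ z : Fin n → EuclideanSpace ℝ (Fin p), Real.exp (θ * ‖taper k (sampleCov z - S)‖)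
      ∂(Measure.pi fun _ => multivariateGaussian 0 S)
      ≤ ((p + k) * (2 * 25 ^ k) + 1) * (2 * Real.exp (1152 * θ ^ 2 * M₀ ^ 2 / n)) := by
  obtain ⟨N, hcard, hN1, hN⟩ := exists_taper_test_vectors p hk
  have hwM : ∀ w ∈ N, w.ofLp ⬝ᵥ (S *ᵥ w.ofLp) ≤ M₀ := fun w hwN => by
    have h1 := hN1 w hwN
    have h2 : ‖w‖ ^ 2 ≤ 1 := pow_le_one₀ (norm_nonneg _) h1
    exact (hw w).trans (mul_le_of_le_one_right hM₀ h2)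
  -- The parameter is ±24θ, with 24 from the test vectors; hence 96 = 4·24 in the range of θ and
  -- 1152 = 2·24² in the exponent.
  have hp := fun w (hwN : w ∈ N) => integrable_and_integral_exp_quadratic_le hn hS (θ := 24 * θ)
    (hwM w hwN) (by rw [abs_of_nonneg (by positivity)]; linarith)
  have hm := fun w (hwN : w ∈ N) => integrable_and_integral_exp_quadratic_le hn hS (θ := -(24 * θ))
    (hwM w hwN) (by rw [abs_neg, abs_of_nonneg (by positivity)]; linarith)
  have hbound : ∀ z : Fin n → EuclideanSpace ℝ (Fin p),
      Real.exp (θ * ‖taper k (sampleCov z - S)‖) ≤ ∑ w ∈ N,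
        (Real.exp (24 * θ * (w.ofLp ⬝ᵥ ((sampleCov z - S) *ᵥ w.ofLp)))
          + Real.exp (-(24 * θ) * (w.ofLp ⬝ᵥ ((sampleCov z - S) *ᵥ w.ofLp)))) := fun z => by
    obtain ⟨w, hwN, hle⟩ := hN _ ((sampleCov_isHermitian z).sub hS.isHermitian)
    calc Real.exp (θ * ‖taper k (sampleCov z - S)‖)
        ≤ Real.exp (24 * θ * |w.ofLp ⬝ᵥ ((sampleCov z - S) *ᵥ w.ofLp)|) := by
          rw [Real.exp_le_exp]
          calc _ ≤ θ * (24 * |w.ofLp ⬝ᵥ ((sampleCov z - S) *ᵥ w.ofLp)|) := by gcongr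
            _ = _ := by ring
      _ ≤ _ := exp_mul_abs_le _ _
      _ ≤ _ := Finset.single_le_sum (f := fun w : EuclideanSpace ℝ (Fin p) =>
          Real.exp (24 * θ * (w.ofLp ⬝ᵥ ((sampleCov z - S) *ᵥ w.ofLp)))
          + Real.exp (-(24 * θ) * (w.ofLp ⬝ᵥ ((sampleCov z - S) *ᵥ w.ofLp))))
          (fun _ _ => by positivity) hwN
  have hint := integrable_finsetSum N fun w hwN => (hp w hwN).1.add (hm w hwN).1
  have hI : Integrable (fun z : Fin n → EuclideanSpace ℝ (Fin p) =>
        Real.exp (θ * ‖taper k (sampleCov z - S)‖))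
      (Measure.pi fun _ => multivariateGaussian 0 S) := by
    refine hint.mono' ?_ (ae_of_all _ fun z => ?_)
    · exact (Real.continuous_exp.comp
        (continuous_const.mul (continuous_norm_taper_sampleCov_sub k S))).aestronglyMeasurable
    · rw [Real.norm_of_nonneg (Real.exp_pos _).le]
      exact hbound z
  refine ⟨hI, ?_⟩
  refine (integral_mono hI hint hbound).trans ?_
  rw [integral_finsetSum N fun w hwN => (hp w hwN).1.add (hm w hwN).1]
  calc _ ≤ ∑ w ∈ N, 2 * Real.exp (1152 * θ ^ 2 * M₀ ^ 2 / n) := by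
        refine Finset.sum_le_sum fun w hwN => ?_
        have e : ∀ x : ℝ, x = 24 * θ ∨ x = -(24 * θ) →
            2 * x ^ 2 * M₀ ^ 2 / n = 1152 * θ ^ 2 * M₀ ^ 2 / n := by
          rintro x (rfl | rfl) <;> ring
        have h1 := (hp w hwN).2
        have h2 := (hm w hwN).2
        rw [e _ (Or.inl rfl)] at h1
        rw [e _ (Or.inr rfl)] at h2
        refine (integral_add (hp w hwN).1 (hm w hwN).1).trans_le ?_
        linarith
    _ = N.card * (2 * Real.exp (1152 * θ ^ 2 * M₀ ^ 2 / n)) := by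
        rw [Finset.sum_const, nsmul_eq_mul]
    _ ≤ _ := by
        gcongr
        exact_mod_cast hcard

end SampleCovariance

/-! ### Scalar inequalities for integration -/

lemma sq_le_of_exp {θ a x : ℝ} (hθ : 0 < θ) (ha : 0 ≤ a) (hx : 0 ≤ x) :
    x ^ 2 ≤ (2 * a ^ 2 + 4 * (Real.exp (-a) * Real.exp (θ * x))) / θ ^ 2 := by
  rw [le_div_iff₀ (by positivity), ← mul_pow, mul_comm x θ, ← Real.exp_add]
  have hy : 0 ≤ θ * x := by positivity
  generalize θ * x = y at hy ⊢
  -- Above a, y² ≤ 2a² + 2(y − a)² and the exponential dominates the second term. With exp a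
  -- bounding the moment, the second moment is only quadratic in a.
  rcases le_total y a with h | h
  · have := Real.exp_pos (-a + y)
    nlinarith
  · have h1 := Real.quadratic_le_exp_of_nonneg (by linarith : 0 ≤ -a + y)
    nlinarith [sq_nonneg (y - 2 * a)]

/-- One factor exp(ηx) dominates x²; the other is at least exp(ηt) when x > t, which yields the
decay exp(−ηt). -/
lemma ite_sq_div_le_exp {η t x ε : ℝ} (hη : 0 < η) (hx : 0 ≤ x) :
    (if t < x then x ^ 2 / ε ^ 2 else 0)
      ≤ 2 / η ^ 2 * Real.exp (-(η * t)) * Real.exp (2 * η * x) / ε ^ 2 := by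
  split_ifs with h
  · gcongr
    have h1 := Real.quadratic_le_exp_of_nonneg (by positivity : 0 ≤ η * x)
    have h2 : x ^ 2 ≤ 2 / η ^ 2 * Real.exp (η * x) := by
      rw [div_mul_eq_mul_div, le_div_iff₀ (by positivity)]
      nlinarith [mul_nonneg hη.le hx]
    refine h2.trans ?_
    rw [mul_assoc, ← Real.exp_add]
    gcongr
    nlinarith
  · positivity

lemma card_test_vectors_le_exp {p k : ℕ} (hp : 0 < p) (hk : 0 < k) :
    (((p : ℝ) + k) * (2 * 25 ^ k) + 1) * 2 ≤ Real.exp (7 * (k + Real.log p)) := by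
  have hp1 : (1 : ℝ) ≤ p := by exact_mod_cast hp
  have h2k : (k : ℝ) + 1 ≤ 2 ^ k := by exact_mod_cast (Nat.lt_two_pow_self (n := k))
  have hlog : 0 ≤ Real.log p := Real.log_nonneg hp1
  have he : (300 : ℝ) ≤ Real.exp 7 := by
    have h1 : Real.exp 7 = Real.exp 1 ^ 7 := by
      rw [← Real.exp_nat_mul]
      norm_num
    rw [h1]
    calc (300 : ℝ) ≤ 2.7 ^ 7 := by norm_num
      _ ≤ _ := by
        gcongr
        linarith [Real.exp_one_gt_d9]
  have h1 : (p : ℝ) + k ≤ p * 2 ^ k := by nlinarith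
  have h50 : (2 : ℝ) ^ k * 25 ^ k = 50 ^ k := by
    rw [← mul_pow]
    norm_num
  have h2 : ((p : ℝ) + k) * (2 * 25 ^ k) ≤ 2 * (p * 50 ^ k) := by
    rw [← h50]
    nlinarith [pow_pos (by norm_num : (0 : ℝ) < 25) k]
  have h3 : (1 : ℝ) ≤ p * 50 ^ k := one_le_mul_of_one_le_of_one_le hp1 (one_le_pow₀ (by norm_num))
  have h6 : (6 : ℝ) ≤ 6 ^ k := by
    calc (6 : ℝ) = 6 ^ 1 := (pow_one _).symm
      _ ≤ 6 ^ k := pow_le_pow_right₀ (by norm_num) hk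
  have h300 : (6 : ℝ) ^ k * 50 ^ k = 300 ^ k := by
    rw [← mul_pow]
    norm_num
  calc (((p : ℝ) + k) * (2 * 25 ^ k) + 1) * 2 ≤ p * (6 * 50 ^ k) := by linarith
    _ ≤ p * 300 ^ k := by
      rw [← h300]
      gcongr
    _ ≤ Real.exp (Real.log p) * Real.exp 7 ^ k := by
      rw [Real.exp_log (by linarith)]
      gcongr
    _ = Real.exp (Real.log p + k * 7) := by rw [← Real.exp_nat_mul, Real.exp_add]
    _ ≤ _ := by
      rw [Real.exp_le_exp]
      linarith

/-! ### Consequences of membership in the bandable class -/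

section Bandable

variable {p : ℕ} {α M M₀ M₁ : ℝ} {S : Matrix (Fin p) (Fin p) ℝ}

/-- In dimension 0 the default `sInf ∅ = 0` contradicts M₁ > 0. -/
lemma pos_of_mem_bandableClass (hM₁ : 0 < M₁) (hS : S ∈ bandableClass p α M M₀ M₁) : 0 < p := by
  rcases Nat.eq_zero_or_pos p with rfl | h
  · have h := hS.2.2.2
    have he : minEig S = 0 := by
      have : spectrum ℝ S = ∅ := spectrum.of_subsingleton S
      rw [minEig, this, Real.sInf_empty]
    linarith
  · exact h

lemma norm_le_of_mem_bandableClass (hM₀ : 0 ≤ M₀) (hS : S ∈ bandableClass p α M M₀ M₁) :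
    ‖S‖ ≤ M₀ := by
  refine l2_opNorm_le_of_quadratic_le S hS.1.isHermitian hM₀ (fun x => ?_) fun x => ?_
  · simpa using hS.1.posSemidef.dotProduct_mulVec_nonneg x.ofLp
  · exact (quadratic_le_maxEig_mul hS.1.isHermitian x).trans
      (mul_le_mul_of_nonneg_right hS.2.2.1 (sq_nonneg _))

lemma half_pos_of_rpow_lt {k : ℕ} {m : ℝ} (hM : 0 < M) (hm : 0 < m)
    (h : (4 * M / m) ^ (1 / α) < ((k / 2 : ℕ) : ℝ)) : 1 ≤ k / 2 := by
  have h1 : 0 < (4 * M / m) ^ (1 / α) := by positivity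
  have h2 : (0 : ℝ) < ((k / 2 : ℕ) : ℝ) := h1.trans h
  exact_mod_cast h2

lemma mul_rpow_neg_le_of_rpow_lt {x m : ℝ} (hα : 0 < α) (hM : 0 < M) (hm : 0 < m)
    (h : (4 * M / m) ^ (1 / α) < x) : M * x ^ (-α) ≤ m / 4 := by
  have h0 : 0 < (4 * M / m) ^ (1 / α) := by positivity
  have hx : 0 < x := h0.trans h
  have h1 : 4 * M / m ≤ x ^ α := by
    have h2 := Real.rpow_le_rpow h0.le h.le hα.le
    rwa [← Real.rpow_mul (by positivity), one_div_mul_cancel hα.ne', Real.rpow_one] at h2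
  rw [Real.rpow_neg hx.le, ← div_eq_mul_inv, div_le_iff₀ (by positivity)]
  rw [div_le_iff₀ hm] at h1
  linarith

lemma rpow_half_neg_sq_le {k : ℕ} (hα : 0 < α) (hk : 1 ≤ k / 2) :
    (((k / 2 : ℕ) : ℝ) ^ (-α)) ^ 2 ≤ (3 : ℝ) ^ (2 * α) * (k : ℝ) ^ (-2 * α) := by
  have h0 : (0 : ℝ) < k := by
    have : 0 < k := by omega
    exact_mod_cast this
  -- The floor costs the factor 3: ⌊k/2⌋ ≥ k/3 for k ≥ 2, with equality at k = 3.
  have h1 : (k : ℝ) / 3 ≤ ((k / 2 : ℕ) : ℝ) := by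
    rw [div_le_iff₀ (by norm_num)]
    have : k ≤ k / 2 * 3 := by omega
    exact_mod_cast this
  have h2 : (0 : ℝ) < (k : ℝ) / 3 := by positivity
  have h3 : ((k / 2 : ℕ) : ℝ) ^ (-α) ≤ ((k : ℝ) / 3) ^ (-α) :=
    Real.rpow_le_rpow_of_nonpos h2 h1 (by linarith)
  calc _ ≤ (((k : ℝ) / 3) ^ (-α)) ^ 2 := by gcongr
    _ = ((k : ℝ) / 3) ^ (-2 * α) := by
      rw [← Real.rpow_natCast, ← Real.rpow_mul h2.le]
      congr 1
      push_cast
      ring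
    _ = _ := by
      rw [Real.div_rpow h0.le (by norm_num), neg_mul, Real.rpow_neg (by norm_num : (0 : ℝ) ≤ 3)]
      field_simp

end Bandable

/-! ### Risk bound -/

/-- Integration of a bound by a quadratic term and a truncated quadratic term, using two
exponential moments. -/
lemma integrable_and_integral_le_of_exp_moments {X : Type*} [MeasurableSpace X] {μ : Measure X}
    [IsProbabilityMeasure μ] {f D : X → ℝ} (hf : AEStronglyMeasurable f μ) (hf0 : ∀ z, 0 ≤ f z)
    (hD : ∀ z, 0 ≤ D z) {C B E ε t θ η a b : ℝ} (hC : 0 ≤ C) (hθ : 0 < θ) (hη : 0 < η)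
    (ha : 0 ≤ a) (hint₁ : Integrable (fun z => Real.exp (θ * D z)) μ)
    (hle₁ : ∫ z, Real.exp (θ * D z) ∂μ ≤ Real.exp a)
    (hint₂ : Integrable (fun z => Real.exp (2 * η * D z)) μ)
    (hle₂ : ∫ z, Real.exp (2 * η * D z) ∂μ ≤ Real.exp b)
    (h : ∀ z, f z ≤ C * (D z ^ 2 + B + E + if t < D z then D z ^ 2 / ε ^ 2 else 0)) :
    Integrable f μ ∧ ∫ z, f z ∂μ ≤ C * ((2 * a ^ 2 + 4) / θ ^ 2 + B + E
      + 2 / η ^ 2 * Real.exp (b - η * t) / ε ^ 2) := by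
  set c₁ := 4 * Real.exp (-a) / θ ^ 2 with hc₁
  set c₂ := 2 / η ^ 2 * Real.exp (-(η * t)) / ε ^ 2 with hc₂
  set c₀ := 2 * a ^ 2 / θ ^ 2 + B + E with hc₀
  set g : X → ℝ := fun z =>
    C * (c₀ + c₁ * Real.exp (θ * D z) + c₂ * Real.exp (2 * η * D z)) with hg
  have hpoint : ∀ z, f z ≤ g z := fun z => by
    refine (h z).trans (mul_le_mul_of_nonneg_left ?_ hC)
    have h1 := sq_le_of_exp hθ ha (hD z)
    have h2 := ite_sq_div_le_exp (t := t) (ε := ε) hη (hD z)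
    have e1 : (2 * a ^ 2 + 4 * (Real.exp (-a) * Real.exp (θ * D z))) / θ ^ 2
        = 2 * a ^ 2 / θ ^ 2 + c₁ * Real.exp (θ * D z) := by
      rw [hc₁]
      ring
    have e2 : 2 / η ^ 2 * Real.exp (-(η * t)) * Real.exp (2 * η * D z) / ε ^ 2
        = c₂ * Real.exp (2 * η * D z) := by
      rw [hc₂]
      ring
    rw [e1] at h1
    rw [e2] at h2
    linarith
  have hi₁ : Integrable (fun z => c₀ + c₁ * Real.exp (θ * D z)) μ :=
    (integrable_const _).add (hint₁.const_mul _)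
  have hi₂ : Integrable (fun z => c₂ * Real.exp (2 * η * D z)) μ := hint₂.const_mul _
  have hgi : Integrable g μ := (hi₁.add hi₂).const_mul C
  have hfi : Integrable f μ := by
    refine hgi.mono' hf (ae_of_all _ fun z => ?_)
    rw [Real.norm_of_nonneg (hf0 z)]
    exact hpoint z
  refine ⟨hfi, (integral_mono hfi hgi hpoint).trans ?_⟩
  have hsplit : ∫ z, g z ∂μ = C * (c₀ + c₁ * ∫ z, Real.exp (θ * D z) ∂μ
      + c₂ * ∫ z, Real.exp (2 * η * D z) ∂μ) := by
    rw [hg, integral_const_mul, integral_add hi₁ hi₂,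
      integral_add (integrable_const _) (hint₁.const_mul _), integral_const_mul,
      integral_const_mul]
    simp
  rw [hsplit]
  refine mul_le_mul_of_nonneg_left ?_ hC
  have h1 : c₁ * ∫ z, Real.exp (θ * D z) ∂μ ≤ 4 / θ ^ 2 := by
    calc _ ≤ c₁ * Real.exp a := by gcongr
      _ = 4 / θ ^ 2 * (Real.exp (-a) * Real.exp a) := by
        rw [hc₁]
        ring
      _ = _ := by rw [← Real.exp_add, neg_add_cancel, Real.exp_zero, mul_one]
  have h2 : c₂ * ∫ z, Real.exp (2 * η * D z) ∂μ ≤ 2 / η ^ 2 * Real.exp (b - η * t) / ε ^ 2 := by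
    calc _ ≤ c₂ * Real.exp b := by gcongr
      _ = 2 / η ^ 2 * (Real.exp b * Real.exp (-(η * t))) / ε ^ 2 := by
        rw [hc₂]
        ring
      _ = _ := by rw [← Real.exp_add, ← sub_eq_add_neg]
  have h3 : (2 * a ^ 2 + 4) / θ ^ 2 = 2 * a ^ 2 / θ ^ 2 + 4 / θ ^ 2 := add_div _ _ _
  linarith

lemma add_le_mul_add {a b c d x y z w K : ℝ} (ha : a ≤ K) (hb : b ≤ K) (hc : c ≤ K) (hd : d ≤ K)
    (hx : 0 ≤ x) (hy : 0 ≤ y) (hz : 0 ≤ z) (hw : 0 ≤ w) :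
    a * x + b * y + c * z + d * w ≤ K * (x + y + z + w) := by
  have w1 := mul_le_mul_of_nonneg_right ha hx
  have w2 := mul_le_mul_of_nonneg_right hb hy
  have w3 := mul_le_mul_of_nonneg_right hc hz
  have w4 := mul_le_mul_of_nonneg_right hd hw
  linarith

/-- Non-asymptotic risk bound under the product Gaussian measure. -/
lemma exists_integral_taperLoss_le {α M M₀ M₁ : ℝ} (hα : 0 < α) (hM : 0 < M) (hM₀ : 0 < M₀)
    (hM₁ : 0 < M₁) :
    ∃ C lam c : ℝ, 0 < C ∧ 0 < lam ∧ 0 < c ∧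
      ∀ (n p₀ q k : ℕ) (ε : ℝ), 0 < n → 0 < ε →
        (k : ℝ) + Real.log ((p₀ + q : ℕ) : ℝ) ≤ c * n →
        ∀ S ∈ bandableClass (p₀ + q) α M M₀ M₁,
          (4 * M / minEig S) ^ (1 / α) < ((k / 2 : ℕ) : ℝ) →
          Integrable (taperLoss (n := n) k ε S) (Measure.pi fun _ => multivariateGaussian 0 S) ∧
          ∫ z, taperLoss (n := n) k ε S z ∂(Measure.pi fun _ => multivariateGaussian 0 S) ≤
            C * (((k : ℝ) + Real.log ((p₀ + q : ℕ) : ℝ)) / n + (k : ℝ) ^ (-2 * α) + ε ^ 2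
              + Real.exp (-lam * n) / ε ^ 2) := by
  obtain ⟨C₁, hC₁, hdet⟩ := exists_norm_regCoef_sub_adjust_sq_le hM₀ hM₁
  set t := M₁ / 4 with ht
  have ht0 : 0 < t := by positivity
  set κ := 1 / (96 * M₀) with hκ
  have hκ0 : 0 < κ := by positivity
  -- The first bound makes 2η = 2δn admissible (192 = 2·96); the second bounds the quadratic
  -- exponent at 2η by ηt/4.
  set δ := min (1 / (192 * M₀)) (t / (16 * (1152 * M₀ ^ 2))) with hδ
  have hδ0 : 0 < δ := by
    rw [hδ]
    positivity
  have hδ1 : 192 * M₀ * δ ≤ 1 := by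
    have := min_le_left (1 / (192 * M₀)) (t / (16 * (1152 * M₀ ^ 2)))
    rw [← hδ, le_div_iff₀ (by positivity)] at this
    linarith
  have hδ2 : 16 * (1152 * M₀ ^ 2) * δ ≤ t := by
    have := min_le_right (1 / (192 * M₀)) (t / (16 * (1152 * M₀ ^ 2)))
    rw [← hδ, le_div_iff₀ (by positivity)] at this
    linarith
  set C₂ := 132 / κ ^ 2 + M ^ 2 * (3 : ℝ) ^ (2 * α) + 1 + 2 / δ ^ 2 with hC₂
  have hs1 : 0 ≤ 132 / κ ^ 2 := by positivity
  have hs2 : 0 ≤ M ^ 2 * (3 : ℝ) ^ (2 * α) := by positivity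
  have hs4 : 0 ≤ 2 / δ ^ 2 := by positivity
  have hc1 : 132 / κ ^ 2 ≤ C₂ := by linarith
  have hc2 : M ^ 2 * (3 : ℝ) ^ (2 * α) ≤ C₂ := by linarith
  have hc3 : 1 ≤ C₂ := by linarith
  have hc4 : 2 / δ ^ 2 ≤ C₂ := by linarith
  -- The constant 28 = 4·7 makes the dimension term 7L at most δtn/4. With the quadratic term the
  -- exponent is at most δtn/2, half of ηt, so the rate δt/2 remains.
  refine ⟨C₁ * C₂, δ * t / 2, min 1 (δ * t / 28), by positivity, by positivity, by positivity, ?_⟩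
  intro n p₀ q k ε hn hε hL S hS hcond
  have hp := pos_of_mem_bandableClass hM₁ hS
  have : NeZero (p₀ + q) := ⟨hp.ne'⟩
  have hn1 : (1 : ℝ) ≤ n := by exact_mod_cast hn
  have hn0 : (0 : ℝ) < n := by linarith
  have hm := hM₁.trans_le hS.2.2.2
  have hk2 := half_pos_of_rpow_lt hM hm hcond
  have hk : 0 < k := by omega
  have hk1 : (1 : ℝ) ≤ k := by exact_mod_cast hk
  have hlog : 0 ≤ Real.log ((p₀ + q : ℕ) : ℝ) := Real.log_nonneg (by exact_mod_cast hp)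
  have hcardexp := card_test_vectors_le_exp hp hk
  set L := (k : ℝ) + Real.log ((p₀ + q : ℕ) : ℝ) with hLdef
  have hL1 : 1 ≤ L := by linarith
  have hLn : L ≤ n := hL.trans (by
    calc _ ≤ 1 * (n : ℝ) := by gcongr; exact min_le_left _ _
      _ = n := one_mul _)
  have hLn2 : 28 * L ≤ δ * t * n := by
    have : L ≤ δ * t / 28 * n := hL.trans (by gcongr; exact min_le_right _ _)
    linarith
  have hnorm := norm_le_of_mem_bandableClass hM₀.le hS
  have hbias := norm_taper_sub_self_le hS hM.le hk2
  have hbias4 := hbias.trans (mul_rpow_neg_le_of_rpow_lt hα hM hm hcond)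
  have hbias2 : ‖taper k S - S‖ ^ 2 ≤ M ^ 2 * (3 : ℝ) ^ (2 * α) * (k : ℝ) ^ (-2 * α) := by
    calc _ ≤ (M * ((k / 2 : ℕ) : ℝ) ^ (-α)) ^ 2 := by gcongr
      _ = M ^ 2 * (((k / 2 : ℕ) : ℝ) ^ (-α)) ^ 2 := mul_pow _ _ _
      _ ≤ M ^ 2 * ((3 : ℝ) ^ (2 * α) * (k : ℝ) ^ (-2 * α)) := by
        gcongr
        exact rpow_half_neg_sq_le hα hk2
      _ = _ := by ring
  have hquad : ∀ w : EuclideanSpace ℝ (Fin (p₀ + q)),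
      w.ofLp ⬝ᵥ (S *ᵥ w.ofLp) ≤ M₀ * ‖w‖ ^ 2 := fun w =>
    (quadratic_le_maxEig_mul hS.1.isHermitian w).trans
      (mul_le_mul_of_nonneg_right hS.2.2.1 (sq_nonneg _))
  set μ := Measure.pi fun _ : Fin n => multivariateGaussian 0 S with hμ
  set Δ : (Fin n → EuclideanSpace ℝ (Fin (p₀ + q))) → ℝ :=
    fun z => ‖taper k (sampleCov z - S)‖ with hΔ
  have hexp : ∀ θ : ℝ, 0 ≤ θ → 96 * θ * M₀ ≤ n →
      Integrable (fun z => Real.exp (θ * Δ z)) μ ∧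
      ∫ z, Real.exp (θ * Δ z) ∂μ ≤ Real.exp (7 * L + 1152 * θ ^ 2 * M₀ ^ 2 / n) :=
    fun θ hθ0 hθ => by
      obtain ⟨h1, h2⟩ := integrable_and_integral_exp_norm_taper_le hn hS.1.posSemidef hk hM₀.le
        hquad hθ0 hθ
      refine ⟨h1, h2.trans ?_⟩
      rw [← mul_assoc, Real.exp_add]
      exact mul_le_mul_of_nonneg_right hcardexp (Real.exp_pos _).le
  -- This balances the exponent: both terms are of order L, namely 7L + L/8 ≤ 8L. It is admissible
  -- because L ≤ n. The constant 132 is 2·8² + 4, using L ≥ 1.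
  set θ := κ * √(n * L) with hθ
  have hsq : √(n * L) ≤ n := by
    rw [Real.sqrt_le_left hn0.le]
    nlinarith
  have hθ0 : 0 < θ := by positivity
  have hθ2 : θ ^ 2 = κ ^ 2 * (n * L) := by
    rw [hθ, mul_pow, Real.sq_sqrt (by positivity)]
  obtain ⟨hint1, hle1⟩ := hexp θ hθ0.le (by
    have : 96 * θ * M₀ = √(n * L) := by
      rw [hθ, hκ]
      field_simp
    rwa [this])
  have hle1' : ∫ z, Real.exp (θ * Δ z) ∂μ ≤ Real.exp (8 * L) := by
    refine hle1.trans ?_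
    rw [Real.exp_le_exp]
    have : 1152 * θ ^ 2 * M₀ ^ 2 / n = L / 8 := by
      rw [hθ2, hκ]
      field_simp
      norm_num
    linarith
  set η := δ * n with hη
  have hη0 : 0 < η := by positivity
  obtain ⟨hint2, hle2⟩ := hexp (2 * η) (by positivity) (by
    have := mul_le_mul_of_nonneg_right hδ1 hn0.le
    rw [hη]
    linarith)
  have hle2' : ∫ z, Real.exp (2 * η * Δ z) ∂μ ≤ Real.exp (δ * t * n / 2) := by
    refine hle2.trans ?_
    rw [Real.exp_le_exp]
    have h1 : 1152 * (2 * η) ^ 2 * M₀ ^ 2 / n = 4 * (1152 * M₀ ^ 2) * δ * (δ * n) := by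
      rw [hη]
      field_simp
      norm_num
    have h2 := mul_le_mul_of_nonneg_right hδ2 hη0.le
    rw [h1, ← hη]
    have h3 : η * t = δ * t * n := by
      rw [hη]
      ring
    linarith
  have hpoint : ∀ z, taperLoss k ε S z ≤ C₁ * (Δ z ^ 2
      + M ^ 2 * (3 : ℝ) ^ (2 * α) * (k : ℝ) ^ (-2 * α) + ε ^ 2
      + if t < Δ z then Δ z ^ 2 / ε ^ 2 else 0) := fun z => by
    have h := hdet p₀ q S (taper k S) (taper k (sampleCov z)) ε hε hS.1.isHermitian
      (taper_isHermitian k (sampleCov_isHermitian z)) hS.2.2.2 hnorm hbias4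
    rw [← taper_sub] at h
    exact h.trans (mul_le_mul_of_nonneg_left (add_le_add_left (add_le_add_left
      (add_le_add_right hbias2 _) _) _) hC₁.le)
  obtain ⟨hI, hle⟩ := integrable_and_integral_le_of_exp_moments
    (continuous_taperLoss k hε S).aestronglyMeasurable (fun z => sq_nonneg _)
    (fun z => norm_nonneg _) hC₁.le hθ0 hη0 (by positivity) hint1 hle1' hint2 hle2' hpoint
  refine ⟨hI, hle.trans ?_⟩
  rw [mul_assoc C₁ C₂]
  refine mul_le_mul_of_nonneg_left ?_ hC₁.le
  have hv1 : (2 * (8 * L) ^ 2 + 4) / θ ^ 2 ≤ 132 / κ ^ 2 * (L / n) := by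
    rw [div_le_iff₀ (by positivity), hθ2]
    have h2 : 132 / κ ^ 2 * (L / n) * (κ ^ 2 * (n * L)) = 132 * L ^ 2 := by field_simp
    rw [h2]
    nlinarith only [hL1]
  have hv2 : 2 / η ^ 2 * Real.exp (δ * t * n / 2 - η * t) / ε ^ 2
      ≤ 2 / δ ^ 2 * (Real.exp (-(δ * t / 2) * n) / ε ^ 2) := by
    have e : δ * t * n / 2 - η * t = -(δ * t / 2) * n := by
      rw [hη]
      ring
    have h1 : δ ≤ η := by
      rw [hη]
      exact le_mul_of_one_le_right hδ0.le hn1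
    have h2 : 2 / η ^ 2 ≤ 2 / δ ^ 2 :=
      div_le_div_of_nonneg_left zero_le_two (by positivity) (pow_le_pow_left₀ hδ0.le h1 2)
    rw [e, mul_div_assoc]
    exact mul_le_mul_of_nonneg_right h2 (by positivity)
  refine le_trans ?_ (add_le_mul_add hc1 hc2 hc3 hc4 (by positivity) (by positivity)
    (sq_nonneg ε) (by positivity))
  rw [one_mul]
  exact add_le_add (add_le_add (add_le_add hv1 le_rfl) le_rfl) hv2

end BandableRegression

open BandableRegression in
theorem theorem2 (α M M₀ M₁ : ℝ) (hα : 0 < α) (hM : 0 < M) (hM₀ : 0 < M₀) (hM₁ : 0 < M₁) :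
    ∃ C lam : ℝ, 0 < C ∧ 0 < lam ∧
      ∀ (p₀ q k : ℕ → ℕ) (ε : ℕ → ℝ), (∀ n, 0 < ε n) →
        (fun n => (k n : ℝ)) =o[atTop] (fun n => (n : ℝ)) →
        (fun n => Real.log ((p₀ n + q n : ℕ) : ℝ)) =o[atTop] (fun n => (n : ℝ)) →
        ∀ᶠ n in atTop, ∀ S ∈ bandableClass (p₀ n + q n) α M M₀ M₁,
          (4 * M / minEig S) ^ (1 / α) < ((k n / 2 : ℕ) : ℝ) →
          ∀ (Ω : Type*) [MeasurableSpace Ω] (P : Measure Ω) [IsProbabilityMeasure P]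
            (Z : Fin n → Ω → EuclideanSpace ℝ (Fin (p₀ n + q n))),
            IsGaussianSample P S Z →
              Integrable (fun ω => taperLoss (k n) (ε n) S (fun i => Z i ω)) P ∧
              ∫ ω, taperLoss (k n) (ε n) S (fun i => Z i ω) ∂P ≤
                C * (((k n : ℝ) + Real.log ((p₀ n + q n : ℕ) : ℝ)) / (n : ℝ)
                  + (k n : ℝ) ^ (-2 * α) + ε n ^ 2
                  + ((p₀ n + q n : ℕ) : ℝ) ^ (1 / 2 : ℝ) * (5 : ℝ) ^ ((k n : ℝ) / 2)
                      * Real.exp (-lam * (n : ℝ)) / ε n ^ 2) := by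
  obtain ⟨C, lam, c, hC, hlam, hc, hmain⟩ := exists_integral_taperLoss_le hα hM hM₀ hM₁
  refine ⟨C, lam, hC, hlam, fun p₀ q k ε hε hk hp => ?_⟩
  -- The two little-o conditions each contribute c/2; the threshold in n does not depend on the
  -- covariance matrix.
  filter_upwards [hk.bound (half_pos hc), hp.bound (half_pos hc), eventually_gt_atTop 0]
    with n hkn hpn hn S hS hcond Ω _ P _ Z hZ
  have hlawZ := hZ.1.hasLaw_pi hZ.2
  have hL : (k n : ℝ) + Real.log ((p₀ n + q n : ℕ) : ℝ) ≤ c * n := by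
    have h1 := (le_abs_self _).trans hkn
    have h2 := (le_abs_self _).trans hpn
    rw [Real.norm_natCast] at h1 h2
    linarith
  obtain ⟨hI, hle⟩ := hmain n (p₀ n) (q n) (k n) (ε n) hn (hε n) hL S hS hcond
  have hpos := pos_of_mem_bandableClass hM₁ hS
  constructor
  -- Integrability gives the risk bound content, since the Bochner integral of a nonintegrable
  -- function is 0 by convention.
  · have hI' := hI
    rw [← hlawZ.map_eq] at hI'
    exact hI'.comp_aemeasurable hlawZ.aemeasurable
  · have heq := hlawZ.integral_comp hI.aestronglyMeasurable
    refine (le_of_eq heq).trans (hle.trans ?_)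
    -- The exponential term was bounded without this prefactor, so being at least 1 suffices.
    have h1 : 1 ≤ ((p₀ n + q n : ℕ) : ℝ) ^ (1 / 2 : ℝ) * (5 : ℝ) ^ ((k n : ℝ) / 2) :=
      one_le_mul_of_one_le_of_one_le
        (Real.one_le_rpow (by exact_mod_cast hpos) (by norm_num))
        (Real.one_le_rpow (by norm_num) (by positivity))
    have h2 := le_mul_of_one_le_left (Real.exp_pos (-lam * n)).le h1
    gcongr
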